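/- **Setting.** Let $D\subset\mathbb R^d$ be a nonempty bounded open set, $\kappa$ a measurable coefficient with $0<\alpha\le\kappa\le\beta<\infty$ on $D$, $f\in L^2(D)$, and let $u\in H^1(D)$ be a weak solution of $-\operatorname{div}(\kappa\nabla u)=f$ in $D$; the values of $u$ on $\partial D$ are prescribed. For every coarse node $i=1,\dots,m$ let open sets $\omega_i=\omega_i^{(n)}\subset\dots\subset\omega_i^{(1)}\subset D$ be given, $n\ge1$: a coarse neighborhood and its nested oversampled regions. For two spectral problems, $n=2$, $\omega_i^{(1)}=\omega_i^+$ and $\omega_i^{(2)}=\omega_i$. At most $N$ of the sets $\omega_i^{(1)}$ overlap at any point. Let $\chi_i^{(j)}$ be Lipschitz functions that vanish in $D\setminus\omega_i^{(j)}$, such that $\chi_i=\chi_i^{(n)}$ is a partition of unity ($\sum_i\chi_i=1$ on $D$) and $|\chi_i^{(j)}|\ge c_0>0$ on $\omega_i^{(j+1)}$ for $1\le j<n$. **Local spaces.** For every $i$ let $\psi^i_1,\dots,\psi^i_{M_i}\in H^1(\omega_i^{(1)})$ be harmonic snapshots, i.e. weak solutions of $-\operatorname{div}(\kappa\nabla\psi)=0$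 in $\omega_i^{(1)}$, and let $b_i\in H^1(\omega_i^{(1)})$ be a fixed weak solution of $-\operatorname{div}(\kappa\nabla b_i)=f$ in $\omega_i^{(1)}$, which carries the source and, where needed, the boundary data ($b_i=0$ is allowed when $f=0$). For every $i,j$ take a bounded measurable weight $\widetilde\kappa_i^{(j)}\ge0$ on $\omega_i^{(j)}$ and the generalized eigenvalue problem $A\Psi=\lambda S\Psi$ with the matrices $$A_{kl}=\int_{\omega_i^{(j)}}\kappa\nabla\psi^i_k\cdot\nabla\psi^i_l,\qquad S_{kl}=\int_{\omega_i^{(j)}}\widetilde\kappa_i^{(j)}\psi^i_k\psi^i_l .$$ Let $\lambda^{(j)}_{i,1}\le\lambda^{(j)}_{i,2}\le\cdots$ be its finite eigenvalues with multiplicity (there are $\operatorname{rank}S$ of them), with $S$-orthonormal eigenvectors. Select the first $L_i^{(j)}$ of them ($0\le L_i^{(j)}<\operatorname{rank}S$), let $V_i^{(j)}$ be the span of the corresponding functions $\sum_l\Psi_l\psi^i_l$, and suppose $\lambda^{(j)}_{i,L_i^{(j)}+1}>0$. Put $\Lambda_*^{(j)}=\min_i\lambda^{(j)}_{i,L_i^{(j)}+1}$.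 **Multiscale solution.** Let $V_{\rm off}$ be the span of all $\chi_i\psi$, $\psi\in V_i^{(1)}\cup\dots\cup V_i^{(n)}$ (the union of the eigenvectors of all the spectral problems). A GMsFEM solution is a function $u_H\in H^1(D)$ with $u_H\in\sum_i\chi_ib_i+V_{\rm off}$, $u_H=u$ on $\partial D$ (that is, $u_H-u\in H_0^1(D)$), and $\int_D\kappa\nabla u_H\cdot\nabla v=\int_Dfv$ for all $v\in V_{\rm off}\cap H^1_0(D)$. **Assumption.** Interpolants can be chosen, $I_i^{(1)}\in b_i+V_i^{(1)}$ and $I_i^{(j)}\in V_i^{(j)}$ for $j\ge2$, such that with $R_i^{(0)}=u$ and $R_i^{(j)}=R_i^{(j-1)}-I_i^{(j)}$ one has, for all $i$ and $1\le j\le n$, $$\int_{\omega_i^{(j)}}\kappa|\nabla\chi_i^{(j)}|^2|R_i^{(j)}|^2\le\frac{C_0}{\lambda^{(j)}_{i,L_i^{(j)}+1}}\int_{\omega_i^{(j)}}\kappa|\nabla R_i^{(j)}|^2,\qquad \int_{\omega_i^{(j)}}\kappa|\nabla R_i^{(j)}|^2\le C_0\int_{\omega_i^{(j)}}\kappa|\nabla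 R_i^{(j-1)}|^2,$$ and such that $R_i^{(j)}$ vanishes on $\partial D\cap\partial\omega_i^{(j)}$, meaning that it is an $H^1(\omega_i^{(j)})$-limit of functions in $H^1(\omega_i^{(j)})$ each of which vanishes outside a compact subset of $D$ (no condition if $\overline{\omega_i^{(j)}}\subset D$). **Claim.** There is a constant $C>0$ that depends only on $n,N,C_0,c_0$ (in particular not on $d$, $D$, $\kappa$, its contrast, $f$, $u$, the coarse mesh, the snapshots, or the eigenvalues) such that every GMsFEM solution satisfies $$\int_D\kappa|\nabla(u-u_H)|^2\le C\,\prod_{j=1}^n\frac1{\Lambda_*^{(j)}}\int_D\kappa|\nabla u|^2 .$$ For two spectral problems this is $\int_D\kappa|\nabla(u-u_H)|^2\le C\,\frac1{\Lambda_*}\,\frac1{\Lambda_*^+}\int_D\kappa|\nabla u|^2$ with $\Lambda_*^+=\Lambda_*^{(1)}$, $\Lambda_*=\Lambda_*^{(2)}$. -/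

import Mathlib

open MeasureTheory Filter Topology
open scoped ContDiff RealInnerProductSpace

namespace GMsFEM

/-- `ℝ^d` with the Euclidean norm. -/
abbrev Sp (d : ℕ) := EuclideanSpace ℝ (Fin d)

/-- A function on `ℝ^d` (first component) together with a vector field that serves as its
gradient (second component). Linear operations are componentwise. What the pair does outside the
set on which it is considered is irrelevant, so restriction to a smaller set is implicit. -/
abbrev GFun (d : ℕ) := (Sp d → ℝ) × (Sp d → Sp d)

/-- `φ ∈ C_c^∞(Ω)`. -/
structure IsTest {d : ℕ} (Ω : Set (Sp d)) (φ : Sp d → ℝ) : Prop where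
  smooth : ContDiff ℝ ∞ φ
  compact : HasCompactSupport φ
  subset : tsupport φ ⊆ Ω

/-- `v.1 ∈ H¹(Ω)`, and `v.2` is its weak gradient in `Ω`. -/
structure MemH1 {d : ℕ} (Ω : Set (Sp d)) (v : GFun d) : Prop where
  memLp_fun : MemLp v.1 2 (volume.restrict Ω)
  memLp_grad : MemLp v.2 2 (volume.restrict Ω)
  weak : ∀ φ : Sp d → ℝ, IsTest Ω φ → ∀ e : Sp d,
    ∫ x in Ω, v.1 x * fderiv ℝ φ x e = - ∫ x in Ω, ⟪v.2 x, e⟫ * φ x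

/-- `v ∈ H¹(Ω)` vanishes on `∂D ∩ ∂Ω`, for an open set `Ω ⊆ D`: it is a limit in `H¹(Ω)` of
functions in `H¹(Ω)`, each of which vanishes outside some compact subset of `D`.
For `Ω = D` this is `v ∈ H¹₀(D)`; if the closure of `Ω` is a compact subset of `D`, every
`v ∈ H¹(Ω)` has the property. -/
def ZeroOnBoundary {d : ℕ} (D Ω : Set (Sp d)) (v : GFun d) : Prop :=
  MemH1 Ω v ∧ ∃ w : ℕ → GFun d,
    (∀ k, MemH1 Ω (w k) ∧ ∃ K : Set (Sp d), IsCompact K ∧ K ⊆ D ∧ ∀ x ∈ Ω \ K, (w k).1 x = 0) ∧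
    Tendsto (fun k => eLpNorm (v.1 - (w k).1) 2 (volume.restrict Ω)) atTop (𝓝 0) ∧
    Tendsto (fun k => eLpNorm (v.2 - (w k).2) 2 (volume.restrict Ω)) atTop (𝓝 0)

/-- The energy form `∫_Ω κ ∇v · ∇w`. -/
noncomputable def energy {d : ℕ} (κ : Sp d → ℝ) (Ω : Set (Sp d)) (v w : GFun d) : ℝ :=
  ∫ x in Ω, κ x * ⟪v.2 x, w.2 x⟫

/-- The weighted mass form `∫_Ω ρ v w`. -/
noncomputable def mass {d : ℕ} (ρ : Sp d → ℝ) (Ω : Set (Sp d)) (v w : GFun d) : ℝ :=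
  ∫ x in Ω, ρ x * (v.1 x * w.1 x)

/-- `v ∈ H¹(Ω)` is a weak solution of `-div (κ ∇v) = f` in `Ω`. -/
def IsWeakSol {d : ℕ} (κ f : Sp d → ℝ) (Ω : Set (Sp d)) (v : GFun d) : Prop :=
  MemH1 Ω v ∧ ∀ φ : Sp d → ℝ, IsTest Ω φ →
    ∫ x in Ω, κ x * fderiv ℝ φ x (v.2 x) = ∫ x in Ω, f x * φ x

/-- `κ` is measurable and bounded between two positive constants on `D`. -/
def IsCoefficient {d : ℕ} (D : Set (Sp d)) (κ : Sp d → ℝ) : Prop :=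
  Measurable κ ∧ ∃ α β : ℝ, 0 < α ∧ ∀ x ∈ D, α ≤ κ x ∧ κ x ≤ β

/-- `ρ` is a measurable, nonnegative and bounded weight on `Ω`. -/
def IsWeight {d : ℕ} (Ω : Set (Sp d)) (ρ : Sp d → ℝ) : Prop :=
  Measurable ρ ∧ ∃ β : ℝ, ∀ x ∈ Ω, 0 ≤ ρ x ∧ ρ x ≤ β

/-- Coarse neighborhoods with nested oversampled regions. There are `m` coarse nodes and `p + 1`
regions for each of them: `Ω i 0 ⊇ Ω i 1 ⊇ ⋯ ⊇ Ω i p`. The last one, `Ω i (Fin.last p)`, is the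
coarse neighborhood `ω_i`, the others are oversampled regions of it. The cutoff `χ i j` is
Lipschitz and vanishes in `D` outside of `Ω i j`; those of the last level form the partition of
unity `χ_i`; each of the others is bounded below by `c₀` on the next smaller region. At most `N`
of the largest regions overlap at a point. -/
structure IsOversampledCover {d m p : ℕ} (D : Set (Sp d)) (N : ℕ) (c₀ : ℝ)
    (Ω : Fin m → Fin (p + 1) → Set (Sp d)) (χ : Fin m → Fin (p + 1) → Sp d → ℝ) : Prop where
  isOpen : ∀ i j, IsOpen (Ω i j)
  subset : ∀ i j, Ω i j ⊆ D
  nested : ∀ i, Antitone (Ω i)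
  overlap : ∀ x ∈ D, Set.ncard {i : Fin m | x ∈ Ω i 0} ≤ N
  lipschitz : ∀ i j, ∃ K, LipschitzWith K (χ i j)
  vanish : ∀ i j, ∀ x ∈ D \ Ω i j, χ i j x = 0
  partition : ∀ x ∈ D, ∑ i, χ i (Fin.last p) x = 1
  lower : ∀ (i : Fin m) (j : Fin p), ∀ x ∈ Ω i j.succ, c₀ ≤ |χ i j.castSucc x|

/-- The linear combination `∑_l c_l ψ_l` of snapshots. -/
noncomputable def combo {d M : ℕ} (ψ : Fin M → GFun d) (c : Fin M → ℝ) : GFun d :=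
  ∑ l, c l • ψ l

/-- Stiffness matrix of the snapshots on `Ω`. -/
noncomputable def stiffnessMatrix {d M : ℕ} (κ : Sp d → ℝ) (Ω : Set (Sp d))
    (ψ : Fin M → GFun d) : Matrix (Fin M) (Fin M) ℝ :=
  Matrix.of fun a b => energy κ Ω (ψ a) (ψ b)

/-- Weighted mass matrix of the snapshots on `Ω`. -/
noncomputable def massMatrix {d M : ℕ} (ρ : Sp d → ℝ) (Ω : Set (Sp d))
    (ψ : Fin M → GFun d) : Matrix (Fin M) (Fin M) ℝ :=
  Matrix.of fun a b => mass ρ Ω (ψ a) (ψ b)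

/-- `lam` lists all (finite) eigenvalues of the generalized eigenvalue problem `A Ψ = λ S Ψ`, with
multiplicity and in increasing order, and `Ψ` lists corresponding `S`-orthonormal eigenvectors.
If the snapshots are linearly independent in the mass form, then `r = M`. -/
structure IsEigensystem {M r : ℕ} (A S : Matrix (Fin M) (Fin M) ℝ) (lam : Fin r → ℝ)
    (Ψ : Fin r → Fin M → ℝ) : Prop where
  complete : r = S.rank
  mono : Monotone lam
  eigen : ∀ k, A.mulVec (Ψ k) = lam k • S.mulVec (Ψ k)
  orthonormal : ∀ k l, Ψ k ⬝ᵥ S.mulVec (Ψ l) = if k = l then 1 else 0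

/-- The span of the first `L` eigenvectors (those with an index less than `L`), as functions. The
index `L` itself, counted from zero, is that of the first eigenvector that is left out. -/
noncomputable def localSpace {d M r : ℕ} (ψ : Fin M → GFun d) (Ψ : Fin r → Fin M → ℝ)
    (L : Fin r) : Submodule ℝ (GFun d) :=
  Submodule.span ℝ {w | ∃ k, k < L ∧ w = combo ψ (Ψ k)}

/-- The offline space: the span of the functions `χ_i ψ`, where `χ i` is the partition of unity
and `ψ` runs through the selected eigenvectors of all the spectral problems at the node `i`. -/
noncomputable def offlineSpace {d m n : ℕ} (χ : Fin m → Sp d → ℝ) {M : Fin m → ℕ}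
    (ψ : ∀ i, Fin (M i) → GFun d) {r : Fin m → Fin n → ℕ}
    (Ψ : ∀ i j, Fin (r i j) → Fin (M i) → ℝ) (L : ∀ i j, Fin (r i j)) :
    Submodule ℝ (Sp d → ℝ) :=
  Submodule.span ℝ {v | ∃ i j k, k < L i j ∧ v = fun x => χ i x * (combo (ψ i) (Ψ i j k)).1 x}

/-- The GMsFEM solution: `uH ∈ ∑_i χ_i b_i + V`, `uH = u` on `∂D`, and
`∫_D κ ∇uH · ∇v = ∫_D f v` for all `v ∈ V` that vanish on `∂D`. -/
structure IsGalerkinSol {d m : ℕ} (D : Set (Sp d)) (κ f : Sp d → ℝ) (u : GFun d)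
    (χ : Fin m → Sp d → ℝ) (b : Fin m → GFun d) (V : Submodule ℝ (Sp d → ℝ))
    (uH : GFun d) : Prop where
  memH1 : MemH1 D uH
  trial : (uH.1 - fun x => ∑ i, χ i x * (b i).1 x) ∈ V
  boundary : ZeroOnBoundary D D (uH - u)
  galerkin : ∀ v : GFun d, v.1 ∈ V → ZeroOnBoundary D D v →
    energy κ D uH v = ∫ x in D, f x * v.1 x

/-- The chain of inequalities
`∫_Ω κ |∇χ|² R² ≤ C₀ λ⁻¹ ∫_Ω κ |∇R|²`, `λ⁻¹ ∫_Ω κ |∇R|² ≤ C₀ λ⁻¹ ∫_Ω κ |∇w|²`,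
where `R` is what remains of `w` after subtracting its interpolant. -/
def InterpolationBound {d : ℕ} (C₀ : ℝ) (κ : Sp d → ℝ) (Ω : Set (Sp d)) (χ : Sp d → ℝ)
    (lam : ℝ) (w R : GFun d) : Prop :=
  mass (fun x => κ x * ‖fderiv ℝ χ x‖ ^ 2) Ω R R ≤ C₀ * (1 / lam * energy κ Ω R R) ∧
  1 / lam * energy κ Ω R R ≤ C₀ * (1 / lam * energy κ Ω w w)

end GMsFEM

/-! Céa's lemma reduces the claim to one competitor. The sums `∑ k, I i k`, glued with the partition
of unity, form an element of the trial space whose error is `∑ χ_i R_i`, where `R_i` is what the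
last level leaves of `u`. The difference of the competitor and `uH` lies in the offline space and in
H¹₀(D), so Galerkin orthogonality (`energy_le_of_orthogonal`) bounds the error by the energy of `∑
χ_i R_i`, and finite overlap splits the latter into local terms (`energy_sum_le`).

Every remainder is harmonic: the function `b i`, subtracted at the first level, cancels the source,
and all else that is subtracted is spanned by harmonic snapshots. Caccioppoli's inequality
(`caccioppoli`) therefore trades the energy weighted with the squared cutoff for the mass weighted
with its squared gradient, and the interpolation bound trades this mass for `1/λ` times the energy
of the preceding remainder. The cutoff of an oversampled region is at least `c₀` on the next one, so
each descent to a smaller region gains one factor `1/Λ` (`energy_le_of_lower`). The energy of `χ_i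
R_i` itself gives the last factor (`energy_cutoffMul_le`).

The analytic work lies in showing that `ηR` and `η²R` are in H¹₀(Ω) although `R` vanishes only on ∂D
∩ ∂Ω. The cutoff `η` vanishes in D outside Ω, but its support may touch ∂Ω. Approximating `R` by
functions that vanish off a compact subset of D, and `η` by its soft truncations, gives compact
support inside Ω; mollification then gives test functions (`ZeroOnBoundary.cutoffMul`,
`MemH1.memH10_of_compact`). In `cutoffMul` the gradient is set to zero where `η = 0`, so that
extension by zero to D is correct at every point. -/

namespace GMsFEM

open scoped Convolution

/-! ### Convolution with bump functions in L². -/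

section Mollification

variable {d : ℕ} {F : Type*} [NormedAddCommGroup F] [NormedSpace ℝ F]

/-- Jensen's inequality for an average over a bump function, in extended nonnegative reals. -/
theorem lintegral_bump_mul_sq_le (φ : ContDiffBump (0 : Sp d)) {G : Sp d → ENNReal}
    (hG : AEMeasurable G volume) :
    (∫⁻ t, ENNReal.ofReal (φ.normed volume t) * G t) ^ 2 ≤
      ∫⁻ t, ENNReal.ofReal (φ.normed volume t) * G t ^ 2 := by
  set ρ : Sp d → ENNReal := fun t => ENNReal.ofReal (φ.normed volume t) with hρ
  have hρm : Measurable ρ := (φ.continuous_normed.measurable).ennreal_ofReal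
  have hρ1 : ∫⁻ t, ρ t = 1 := by
    rw [hρ, ← ofReal_integral_eq_lintegral_ofReal φ.integrable_normed
      (Eventually.of_forall φ.nonneg_normed), φ.integral_normed, ENNReal.ofReal_one]
  -- Hölder against the constant one in the probability measure with density `ρ`: the factor coming
  -- from the constant is its total mass, one.
  have h := ENNReal.lintegral_mul_le_Lp_mul_Lq (volume.withDensity ρ)
    (Real.HolderConjugate.two_two) (f := fun _ => 1) (g := G) aemeasurable_const
    (hG.mono_ac (withDensity_absolutelyContinuous _ _))
  have hν : (volume.withDensity ρ) Set.univ = 1 := by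
    rw [withDensity_apply _ MeasurableSet.univ, Measure.restrict_univ, hρ1]
  simp only [Pi.mul_apply, one_mul, ENNReal.one_rpow, lintegral_const, hν] at h
  rw [lintegral_withDensity_eq_lintegral_mul₀ hρm.aemeasurable hG,
    lintegral_withDensity_eq_lintegral_mul₀ hρm.aemeasurable (hG.pow_const _)] at h
  calc (∫⁻ t, ρ t * G t) ^ 2
      ≤ ((∫⁻ t, (ρ * fun t => G t ^ (2 : ℝ)) t) ^ (1 / 2 : ℝ)) ^ 2 := by gcongr; exact h
    _ = ∫⁻ t, ρ t * G t ^ 2 := by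
        rw [← ENNReal.rpow_natCast, ← ENNReal.rpow_mul]
        norm_num

/-- Young's inequality for convolution with a bump function of integral one. -/
theorem eLpNorm_bump_convolution_le (φ : ContDiffBump (0 : Sp d)) {g : Sp d → F}
    (hg : AEStronglyMeasurable g volume) :
    eLpNorm (φ.normed volume ⋆[ContinuousLinearMap.lsmul ℝ ℝ, volume] g) 2 volume ≤
      eLpNorm g 2 volume := by
  have hρm : Measurable fun t => ENNReal.ofReal (φ.normed volume t) :=
    (φ.continuous_normed.measurable).ennreal_ofReal
  have hρ1 : ∫⁻ t, ENNReal.ofReal (φ.normed volume t) = 1 := by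
    rw [← ofReal_integral_eq_lintegral_ofReal φ.integrable_normed
      (Eventually.of_forall φ.nonneg_normed), φ.integral_normed, ENNReal.ofReal_one]
  have hsub (x : Sp d) : AEMeasurable (fun t => ‖g (x - t)‖ₑ) volume :=
    (hg.comp_quasiMeasurePreserving
      (Measure.measurePreserving_sub_left volume x).quasiMeasurePreserving).enorm
  have hpt (x : Sp d) :
      ‖(φ.normed volume ⋆[ContinuousLinearMap.lsmul ℝ ℝ, volume] g) x‖ₑ ^ 2 ≤
        ∫⁻ t, ENNReal.ofReal (φ.normed volume t) * ‖g (x - t)‖ₑ ^ 2 := by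
    refine le_trans ?_ (lintegral_bump_mul_sq_le φ (hsub x))
    gcongr
    refine (enorm_integral_le_lintegral_enorm _).trans (le_of_eq ?_)
    refine lintegral_congr fun t => ?_
    simp only [ContinuousLinearMap.lsmul_apply, enorm_smul]
    rw [Real.enorm_of_nonneg (φ.nonneg_normed t)]
  have key : ∫⁻ x, ‖(φ.normed volume ⋆[ContinuousLinearMap.lsmul ℝ ℝ, volume] g) x‖ₑ ^ 2 ≤
      ∫⁻ x, ‖g x‖ₑ ^ 2 := by
    refine (lintegral_mono hpt).trans ?_
    rw [lintegral_lintegral_swap]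
    · have (t : Sp d) : ∫⁻ x, ENNReal.ofReal (φ.normed volume t) * ‖g (x - t)‖ₑ ^ 2 =
          ENNReal.ofReal (φ.normed volume t) * ∫⁻ x, ‖g x‖ₑ ^ 2 := by
        rw [lintegral_const_mul' _ _ ENNReal.ofReal_ne_top,
          lintegral_sub_right_eq_self (fun x => ‖g x‖ₑ ^ 2) t]
      simp_rw [this]
      rw [lintegral_mul_const _ hρm, hρ1, one_mul]
    · refine AEMeasurable.mul (hρm.comp measurable_snd).aemeasurable ?_
      exact ((hg.comp_quasiMeasurePreserving
        (quasiMeasurePreserving_sub volume volume)).enorm).pow_const 2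
  rw [eLpNorm_eq_lintegral_rpow_enorm_toReal (by norm_num) (by norm_num),
    eLpNorm_eq_lintegral_rpow_enorm_toReal (by norm_num) (by norm_num)]
  simp only [ENNReal.toReal_ofNat]
  refine ENNReal.rpow_le_rpow ?_ (by norm_num)
  simpa using key

/-- Mollifications converge in `L²`. -/
theorem exists_eLpNorm_bump_convolution_sub_le [CompleteSpace F] {g : Sp d → F}
    (hg : MemLp g 2 volume) {ε : ENNReal} (hε : ε ≠ 0) :
    ∃ δ : ℝ, 0 < δ ∧ ∀ φ : ContDiffBump (0 : Sp d), φ.rOut ≤ δ →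
      eLpNorm (φ.normed volume ⋆[ContinuousLinearMap.lsmul ℝ ℝ, volume] g - g) 2 volume ≤ ε := by
  have hε3 : ε / 3 ≠ 0 := by simp [hε]
  obtain ⟨h, hsupp, hgh, hc, hmem⟩ := hg.exists_hasCompactSupport_eLpNorm_sub_le (by simp) hε3
  obtain ⟨R, hR⟩ := hsupp.isCompact.isBounded.subset_closedBall (0 : Sp d)
  -- The kernels will have radius at most one, so this ball contains the supports of `h` and of its
  -- mollification. On it a uniform error `η` costs at most `V ^ (1/2) * η` in L².
  set V : ENNReal := volume (Metric.closedBall (0 : Sp d) (R + 1)) with hV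
  have hVt : V ≠ ⊤ := measure_closedBall_lt_top.ne
  obtain ⟨η, hη0, hη⟩ : ∃ η : ℝ, 0 < η ∧ V ^ (1 / 2 : ℝ) * ENNReal.ofReal η ≤ ε / 3 := by
    have ht : Tendsto (fun η : ℝ => V ^ (1 / 2 : ℝ) * ENNReal.ofReal η) (𝓝[>] 0)
        (𝓝 (V ^ (1 / 2 : ℝ) * ENNReal.ofReal 0)) :=
      ENNReal.Tendsto.const_mul
        ((ENNReal.continuous_ofReal.tendsto 0).mono_left nhdsWithin_le_nhds)
        (Or.inr (ENNReal.rpow_ne_top_of_nonneg (by norm_num) hVt))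
    rw [ENNReal.ofReal_zero, mul_zero] at ht
    have := (ht.eventually_lt_const (pos_iff_ne_zero.2 hε3)).and self_mem_nhdsWithin
    obtain ⟨η, h1, h2⟩ := this.exists
    exact ⟨η, h2, h1.le⟩
  obtain ⟨δ, hδ0, hδ⟩ := Metric.uniformContinuous_iff.1
    (hc.uniformContinuous_of_tendsto_cocompact hsupp.is_zero_at_infty) η hη0
  refine ⟨min δ 1, by positivity, fun φ hφ => ?_⟩
  set T : (Sp d → F) → (Sp d → F) :=
    fun g => φ.normed volume ⋆[ContinuousLinearMap.lsmul ℝ ℝ, volume] g with hT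
  have hex (g : Sp d → F) (hg : MemLp g 2 volume) :
      ConvolutionExists (φ.normed volume) g (ContinuousLinearMap.lsmul ℝ ℝ) volume :=
    φ.hasCompactSupport_normed.convolutionExists_left _ φ.continuous_normed
      (hg.locallyIntegrable (by norm_num))
  have hcont (g : Sp d → F) (hg : MemLp g 2 volume) : Continuous (T g) :=
    φ.hasCompactSupport_normed.continuous_convolution_left _ φ.continuous_normed
      (hg.locallyIntegrable (by norm_num))
  -- Only the middle term needs the continuity of `h`; the other two are small by density, the first
  -- through Young's inequality.
  have hsplit : T g - g = (T (g - h) + (T h - h)) - (g - h) := by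
    have : T g = T (g - h) + T h := by
      rw [hT]
      have := (hex (g - h) (hg.sub hmem)).distrib_add (hex h hmem)
      simp only [sub_add_cancel] at this
      exact this
    rw [this]; abel
  have h3 : eLpNorm (T h - h) 2 volume ≤ ε / 3 := by
    refine le_trans ?_ hη
    have hz : ∀ x, x ∉ Metric.closedBall (0 : Sp d) (R + 1) → (T h - h) x = 0 := by
      intro x hx
      have hball : ∀ y, dist y x ≤ 1 → h y = 0 := by
        intro y hy
        by_contra hne
        have h1 := hR (subset_tsupport _ (Function.mem_support.2 hne))
        rw [Metric.mem_closedBall] at h1 hx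
        have := dist_triangle x y 0
        rw [dist_comm x y] at this
        linarith
      have h2 : T h x = h x := φ.normed_convolution_eq_right fun y hy => by
        rw [hball y ((Metric.mem_ball.1 hy).le.trans (hφ.trans (min_le_right _ _))),
          hball x (by simp)]
      simp [h2]
    have hb : ∀ x, ‖(T h - h) x‖ ≤ η := by
      intro x
      rw [Pi.sub_apply, ← dist_eq_norm]
      refine φ.dist_normed_convolution_le hc.aestronglyMeasurable fun y hy => (hδ ?_).le
      exact (Metric.mem_ball.1 hy).trans_le (hφ.trans (min_le_left _ _))
    calc eLpNorm (T h - h) 2 volume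
        = eLpNorm (T h - h) 2 (volume.restrict (Metric.closedBall (0 : Sp d) (R + 1))) := by
          rw [← eLpNorm_indicator_eq_eLpNorm_restrict measurableSet_closedBall]
          congr 1
          symm
          rw [Set.indicator_eq_self]
          intro x hx
          by_contra hne
          exact hx (hz x hne)
      _ ≤ (volume.restrict (Metric.closedBall (0 : Sp d) (R + 1))) Set.univ ^
            ((2 : ENNReal).toReal)⁻¹ * ENNReal.ofReal η :=
          eLpNorm_le_of_ae_bound (Eventually.of_forall hb)
      _ = V ^ (1 / 2 : ℝ) * ENNReal.ofReal η := by simp [hV]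
  have hTm (g : Sp d → F) (hg : MemLp g 2 volume) : AEStronglyMeasurable (T g) volume :=
    (hcont g hg).aestronglyMeasurable
  calc eLpNorm (T g - g) 2 volume
      ≤ eLpNorm (T (g - h)) 2 volume + eLpNorm (T h - h) 2 volume + eLpNorm (g - h) 2 volume := by
        rw [hsplit]
        refine (eLpNorm_sub_le ?_ (hg.sub hmem).1 (by norm_num)).trans ?_
        · exact (hTm _ (hg.sub hmem)).add ((hTm _ hmem).sub hmem.1)
        · gcongr
          exact eLpNorm_add_le (hTm _ (hg.sub hmem)) ((hTm _ hmem).sub hmem.1) (by norm_num)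
    _ ≤ ε / 3 + ε / 3 + ε / 3 := by
        gcongr
        exact (eLpNorm_bump_convolution_le φ (hg.sub hmem).1).trans hgh
    _ = ε := ENNReal.add_thirds ε

end Mollification

/-! ### Continuity of L² pairings. -/

section Integrals

variable {d : ℕ} {F : Type*} [NormedAddCommGroup F]

theorem memLp_smul_of_bound [NormedSpace ℝ F] {μ : Measure (Sp d)} {φ : Sp d → ℝ} {g : Sp d → F}
    (hφ : AEStronglyMeasurable φ μ) {c : ℝ} (hc : ∀ᵐ x ∂μ, ‖φ x‖ ≤ c) (hg : MemLp g 2 μ) :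
    MemLp (fun x => φ x • g x) 2 μ := by
  refine hg.of_le_mul (c := c) (hφ.smul hg.1) ?_
  filter_upwards [hc] with x hx
  rw [norm_smul]
  gcongr

variable [InnerProductSpace ℝ F]

theorem integrable_inner_of_memLp {μ : Measure (Sp d)} {a b : Sp d → F} (ha : MemLp a 2 μ)
    (hb : MemLp b 2 μ) : Integrable (fun x => ⟪a x, b x⟫) μ := by
  rw [← memLp_one_iff_integrable]
  refine MemLp.of_bilin (fun u v => ⟪u, v⟫) 1 ha hb (ha.1.inner hb.1) (Eventually.of_forall ?_)
  intro x
  simpa using nnnorm_inner_le_nnnorm (𝕜 := ℝ) (a x) (b x)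

/-- The `L²` pairing is continuous in its second argument. -/
theorem tendsto_integral_inner {μ : Measure (Sp d)} {a b : Sp d → F} {w : ℕ → Sp d → F}
    (ha : MemLp a 2 μ) (hb : MemLp b 2 μ) (hw : ∀ k, MemLp (w k) 2 μ)
    (hlim : Tendsto (fun k => eLpNorm (b - w k) 2 μ) atTop (𝓝 0)) :
    Tendsto (fun k => ∫ x, ⟪a x, w k x⟫ ∂μ) atTop (𝓝 (∫ x, ⟪a x, b x⟫ ∂μ)) := by
  refine tendsto_integral_of_L1' _ (integrable_inner_of_memLp ha hb).1
    (Eventually.of_forall fun k => integrable_inner_of_memLp ha (hw k)) ?_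
  have hbound (k : ℕ) : eLpNorm ((fun x => ⟪a x, w k x⟫) - fun x => ⟪a x, b x⟫) 1 μ ≤
      eLpNorm a 2 μ * eLpNorm (b - w k) 2 μ := by
    have h := eLpNorm_le_eLpNorm_mul_eLpNorm_of_nnnorm (p := 2) (q := 2) (r := 1) ha.1
      (hb.sub (hw k)).1 (fun u v => ⟪u, v⟫) 1 (Eventually.of_forall fun x => by
        simpa using nnnorm_inner_le_nnnorm (𝕜 := ℝ) (a x) ((b - w k) x))
    have he : ((fun x => ⟪a x, w k x⟫) - fun x => ⟪a x, b x⟫) =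
        -fun x => ⟪a x, (b - w k) x⟫ := by
      ext x
      simp [inner_sub_right]
    rw [he, eLpNorm_neg]
    simpa using h
  have h0 : Tendsto (fun k => eLpNorm a 2 μ * eLpNorm (b - w k) 2 μ) atTop (𝓝 0) := by
    simpa using ENNReal.Tendsto.const_mul hlim (Or.inr ha.2.ne)
  exact tendsto_of_tendsto_of_tendsto_of_le_of_le tendsto_const_nhds h0 (fun _ => zero_le)
    hbound

theorem tendsto_integral_mul {μ : Measure (Sp d)} {a b : Sp d → ℝ} {w : ℕ → Sp d → ℝ}
    (ha : MemLp a 2 μ) (hb : MemLp b 2 μ) (hw : ∀ k, MemLp (w k) 2 μ)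
    (hlim : Tendsto (fun k => eLpNorm (b - w k) 2 μ) atTop (𝓝 0)) :
    Tendsto (fun k => ∫ x, a x * w k x ∂μ) atTop (𝓝 (∫ x, a x * b x ∂μ)) := by
  simpa [mul_comm] using tendsto_integral_inner ha hb hw hlim

end Integrals

/-! ### Test functions, Lipschitz functions and the space H¹. -/

section Sobolev

variable {d : ℕ} {Ω D : Set (Sp d)}

theorem IsTest.mono {φ : Sp d → ℝ} (h : IsTest Ω φ) (hsub : Ω ⊆ D) : IsTest D φ :=
  ⟨h.smooth, h.compact, h.subset.trans hsub⟩

theorem norm_gradient (φ : Sp d → ℝ) (x : Sp d) : ‖gradient φ x‖ = ‖fderiv ℝ φ x‖ :=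
  LinearIsometryEquiv.norm_map _ _

theorem norm_gradient_le {η : Sp d → ℝ} {K : NNReal} (hη : LipschitzWith K η) (x : Sp d) :
    ‖gradient η x‖ ≤ K := by
  rw [norm_gradient]
  exact norm_fderiv_le_of_lipschitz ℝ hη

theorem measurable_gradient (φ : Sp d → ℝ) : Measurable (gradient φ) :=
  (InnerProductSpace.toDual ℝ (Sp d)).symm.continuous.measurable.comp (measurable_fderiv ℝ φ)

theorem IsTest.differentiable {φ : Sp d → ℝ} (h : IsTest Ω φ) : Differentiable ℝ φ :=
  h.smooth.differentiable (by simp)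

theorem IsTest.exists_lipschitz {φ : Sp d → ℝ} (h : IsTest Ω φ) : ∃ K, LipschitzWith K φ :=
  ContDiff.lipschitzWith_of_hasCompactSupport h.compact h.smooth (by simp)

theorem IsTest.eq_zero {φ : Sp d → ℝ} (h : IsTest Ω φ) {x : Sp d} (hx : x ∉ Ω) : φ x = 0 :=
  image_eq_zero_of_notMem_tsupport fun h' => hx (h.subset h')

theorem fderiv_eq_zero_of_notMem_tsupport {φ : Sp d → ℝ} {x : Sp d} (hx : x ∉ tsupport φ) :
    fderiv ℝ φ x = 0 :=
  image_eq_zero_of_notMem_tsupport fun h => hx (tsupport_fderiv_subset ℝ h)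

theorem gradient_eq_zero_of_notMem_tsupport {φ : Sp d → ℝ} {x : Sp d} (hx : x ∉ tsupport φ) :
    gradient φ x = 0 := by
  rw [← norm_eq_zero, norm_gradient, fderiv_eq_zero_of_notMem_tsupport hx, norm_zero]

/-- A Lipschitz function with compact support is square integrable, with its gradient. -/
theorem memLp_of_lipschitz_compact {η : Sp d → ℝ} {K : NNReal} (hη : LipschitzWith K η)
    (hc : HasCompactSupport η) (μ : Measure (Sp d)) [IsFiniteMeasureOnCompacts μ] :
    MemLp η 2 μ ∧ MemLp (gradient η) 2 μ := by
  refine ⟨hη.continuous.memLp_of_hasCompactSupport hc, ?_⟩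
  have hsup : Function.support (gradient η) ⊆ tsupport η := fun x hx => by
    by_contra h
    exact hx (gradient_eq_zero_of_notMem_tsupport h)
  rw [← Set.indicator_eq_self.2 hsup,
    memLp_indicator_iff_restrict (isClosed_tsupport η).measurableSet]
  have : IsFiniteMeasure (μ.restrict (tsupport η)) :=
    ⟨by simpa using hc.isCompact.measure_lt_top⟩
  exact MemLp.of_bound (measurable_gradient η).aestronglyMeasurable K
    (Eventually.of_forall (norm_gradient_le hη))

/-- Integration by parts for Lipschitz functions. -/
theorem integral_lipschitz_mul_fderiv {η φ : Sp d → ℝ} {K K' : NNReal} (hη : LipschitzWith K η)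
    (hφ : LipschitzWith K' φ) (hφc : HasCompactSupport φ) (hsub : tsupport φ ⊆ Ω) (e : Sp d) :
    ∫ x in Ω, η x * fderiv ℝ φ x e = - ∫ x in Ω, ⟪gradient η x, e⟫ * φ x := by
  rw [setIntegral_eq_integral_of_forall_compl_eq_zero fun x hx => by
      rw [fderiv_eq_zero_of_notMem_tsupport fun h => hx (hsub h)]; simp,
    setIntegral_eq_integral_of_forall_compl_eq_zero fun x hx => by
      rw [image_eq_zero_of_notMem_tsupport fun h => hx (hsub h)]; simp]
  -- This identity is about line derivatives; Rademacher's theorem turns them into pairings with the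
  -- gradient almost everywhere.
  have h := hη.integral_lineDeriv_mul_eq (μ := volume) hφ hφc e
  have h1 : ∫ x, lineDeriv ℝ η x e * φ x = ∫ x, ⟪gradient η x, e⟫ * φ x := by
    refine integral_congr_ae ?_
    filter_upwards [hη.ae_differentiableAt (μ := volume)] with x hx
    rw [hx.lineDeriv_eq_fderiv, inner_gradient_left]
  have h2 : ∫ x, lineDeriv ℝ φ x (-e) * η x = - ∫ x, η x * fderiv ℝ φ x e := by
    rw [← integral_neg]
    refine integral_congr_ae ?_
    filter_upwards [hφ.ae_differentiableAt (μ := volume)] with x hx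
    rw [hx.lineDeriv_eq_fderiv, map_neg]
    ring
  rw [h1, h2] at h
  rw [h, neg_neg]

theorem memH1_of_lipschitz_compact {η : Sp d → ℝ} {K : NNReal} (hη : LipschitzWith K η)
    (hc : HasCompactSupport η) : MemH1 Ω (η, gradient η) := by
  obtain ⟨h1, h2⟩ := memLp_of_lipschitz_compact hη hc (volume.restrict Ω)
  refine ⟨h1, h2, fun φ hφ e => ?_⟩
  obtain ⟨K', hK'⟩ := hφ.exists_lipschitz
  exact integral_lipschitz_mul_fderiv hη hK' hφ.compact hφ.subset e

theorem IsTest.memH1 {φ : Sp d → ℝ} (h : IsTest Ω φ) : MemH1 Ω (φ, gradient φ) := by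
  obtain ⟨K, hK⟩ := h.exists_lipschitz
  exact memH1_of_lipschitz_compact hK h.compact

theorem IsTest.memLp {φ : Sp d → ℝ} (h : IsTest Ω φ) (μ : Measure (Sp d))
    [IsFiniteMeasureOnCompacts μ] : MemLp φ 2 μ ∧ MemLp (gradient φ) 2 μ := by
  obtain ⟨K, hK⟩ := h.exists_lipschitz
  exact memLp_of_lipschitz_compact hK h.compact μ

theorem IsTest.memLp_fderiv {φ : Sp d → ℝ} (h : IsTest Ω φ) (μ : Measure (Sp d))
    [IsFiniteMeasureOnCompacts μ] (e : Sp d) : MemLp (fun x => fderiv ℝ φ x e) 2 μ := by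
  simp_rw [← inner_gradient_left]
  exact (h.memLp μ).2.inner_const e

theorem MemH1.mono {v : GFun d} (hv : MemH1 D v) (hsub : Ω ⊆ D) (hD : MeasurableSet D) : MemH1 Ω v := by
  refine ⟨hv.memLp_fun.mono_measure (Measure.restrict_mono hsub le_rfl),
    hv.memLp_grad.mono_measure (Measure.restrict_mono hsub le_rfl), fun φ hφ e => ?_⟩
  have h := hv.weak φ (hφ.mono hsub) e
  rwa [setIntegral_eq_of_subset_of_forall_sdiff_eq_zero hD hsub fun x hx => by
      rw [fderiv_eq_zero_of_notMem_tsupport fun h => hx.2 (hφ.subset h)]; simp,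
    setIntegral_eq_of_subset_of_forall_sdiff_eq_zero hD hsub fun x hx => by
      rw [hφ.eq_zero hx.2]; simp] at h

theorem MemH1.add {v w : GFun d} (hv : MemH1 Ω v) (hw : MemH1 Ω w) : MemH1 Ω (v + w) := by
  refine ⟨hv.memLp_fun.add hw.memLp_fun, hv.memLp_grad.add hw.memLp_grad, fun φ hφ e => ?_⟩
  have hi := fun (u : GFun d) (hu : MemH1 Ω u) =>
    hu.memLp_fun.integrable_mul (hφ.memLp_fderiv (volume.restrict Ω) e)
  have hj := fun (u : GFun d) (hu : MemH1 Ω u) =>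
    (hu.memLp_grad.inner_const e).integrable_mul (hφ.memLp (volume.restrict Ω)).1
  have h1 := integral_add (hi v hv) (hi w hw)
  have h2 := integral_add (hj v hv) (hj w hw)
  simp only [Pi.mul_apply] at h1 h2
  simp only [Prod.fst_add, Prod.snd_add, Pi.add_apply, add_mul, inner_add_left]
  rw [h1, h2, hv.weak φ hφ e, hw.weak φ hφ e]
  ring

theorem MemH1.smul {v : GFun d} (c : ℝ) (hv : MemH1 Ω v) : MemH1 Ω (c • v) := by
  refine ⟨hv.memLp_fun.const_smul c, hv.memLp_grad.const_smul c, fun φ hφ e => ?_⟩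
  simp only [Prod.smul_fst, Prod.smul_snd, Pi.smul_apply, smul_eq_mul, mul_assoc,
    real_inner_smul_left]
  rw [integral_const_mul, integral_const_mul, hv.weak φ hφ e]
  ring

theorem MemH1.zero : MemH1 Ω (0 : GFun d) :=
  ⟨MemLp.zero, MemLp.zero, fun φ _ e => by simp⟩

theorem MemH1.sub {v w : GFun d} (hv : MemH1 Ω v) (hw : MemH1 Ω w) : MemH1 Ω (v - w) := by
  rw [sub_eq_add_neg, ← neg_one_smul ℝ w]
  exact hv.add (hw.smul _)

/-- A limit of functions in `H¹(Ω)` is in `H¹(Ω)`. -/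
theorem MemH1.of_tendsto {v : GFun d} {w : ℕ → GFun d} (h1 : MemLp v.1 2 (volume.restrict Ω))
    (h2 : MemLp v.2 2 (volume.restrict Ω)) (hw : ∀ k, MemH1 Ω (w k))
    (l1 : Tendsto (fun k => eLpNorm (v.1 - (w k).1) 2 (volume.restrict Ω)) atTop (𝓝 0))
    (l2 : Tendsto (fun k => eLpNorm (v.2 - (w k).2) 2 (volume.restrict Ω)) atTop (𝓝 0)) :
    MemH1 Ω v := by
  refine ⟨h1, h2, fun φ hφ e => ?_⟩
  have t1 := tendsto_integral_mul (hφ.memLp_fderiv (volume.restrict Ω) e) h1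
    (fun k => (hw k).memLp_fun) l1
  have ha : MemLp (fun x => φ x • e) 2 (volume.restrict Ω) :=
    (hφ.smooth.continuous.smul continuous_const).memLp_of_hasCompactSupport hφ.compact.smul_right
  have t2 := tendsto_integral_inner ha h2 (fun k => (hw k).memLp_grad) l2
  have hin (a : Sp d) (x : Sp d) : ⟪φ x • e, a⟫ = ⟪a, e⟫ * φ x := by
    rw [real_inner_smul_left, real_inner_comm, mul_comm]
  have he (k : ℕ) : ∫ x in Ω, fderiv ℝ φ x e * (w k).1 x =
      - ∫ x in Ω, ⟪φ x • e, (w k).2 x⟫ := by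
    simp_rw [hin, ← (hw k).weak φ hφ e, mul_comm]
  simp_rw [he] at t1
  have := tendsto_nhds_unique t1 t2.neg
  simp_rw [hin] at this
  rw [← this]
  simp_rw [mul_comm]

end Sobolev

open scoped Manifold

/-! ### The space H¹₀ as a closure of test functions. -/

section Density

variable {d : ℕ} {Ω D : Set (Sp d)}

/-- `v ∈ H¹₀(Ω)`: square integrable, with its gradient, and a limit of test functions. -/
structure MemH10 (Ω : Set (Sp d)) (v : GFun d) : Prop where
  memLp_fun : MemLp v.1 2 (volume.restrict Ω)
  memLp_grad : MemLp v.2 2 (volume.restrict Ω)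
  approx : ∀ ε : ENNReal, ε ≠ 0 → ∃ φ, IsTest Ω φ ∧
    eLpNorm (v.1 - φ) 2 (volume.restrict Ω) ≤ ε ∧
    eLpNorm (v.2 - gradient φ) 2 (volume.restrict Ω) ≤ ε

theorem MemH10.exists_seq {v : GFun d} (h : MemH10 Ω v) : ∃ φ : ℕ → Sp d → ℝ,
    (∀ k, IsTest Ω (φ k)) ∧
    Tendsto (fun k => eLpNorm (v.1 - φ k) 2 (volume.restrict Ω)) atTop (𝓝 0) ∧
    Tendsto (fun k => eLpNorm (v.2 - gradient (φ k)) 2 (volume.restrict Ω)) atTop (𝓝 0) := by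
  -- For `k = 0` the tolerance is `⊤`, which is nonzero and does no harm to the limit.
  choose φ h1 h2 h3 using fun k : ℕ => h.approx (k : ENNReal)⁻¹
    (ENNReal.inv_ne_zero.2 (ENNReal.natCast_ne_top k))
  exact ⟨φ, h1, tendsto_of_tendsto_of_tendsto_of_le_of_le tendsto_const_nhds
      ENNReal.tendsto_inv_nat_nhds_zero (fun _ => zero_le) h2,
    tendsto_of_tendsto_of_tendsto_of_le_of_le tendsto_const_nhds
      ENNReal.tendsto_inv_nat_nhds_zero (fun _ => zero_le) h3⟩

theorem MemH10.memH1 {v : GFun d} (h : MemH10 Ω v) : MemH1 Ω v := by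
  obtain ⟨φ, h1, h2, h3⟩ := h.exists_seq
  exact MemH1.of_tendsto (w := fun k => (φ k, gradient (φ k))) h.memLp_fun h.memLp_grad
    (fun k => (h1 k).memH1) h2 h3

/-- `H¹₀(Ω)` is closed in `H¹(Ω)`. -/
theorem MemH10.of_tendsto {v : GFun d} {w : ℕ → GFun d}
    (h1 : MemLp v.1 2 (volume.restrict Ω)) (h2 : MemLp v.2 2 (volume.restrict Ω))
    (hw : ∀ k, MemH10 Ω (w k))
    (l1 : Tendsto (fun k => eLpNorm (v.1 - (w k).1) 2 (volume.restrict Ω)) atTop (𝓝 0))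
    (l2 : Tendsto (fun k => eLpNorm (v.2 - (w k).2) 2 (volume.restrict Ω)) atTop (𝓝 0)) :
    MemH10 Ω v := by
  refine ⟨h1, h2, fun ε hε => ?_⟩
  have hε2 : 0 < ε / 2 := ENNReal.half_pos hε
  obtain ⟨k, hk1, hk2⟩ := ((l1.eventually_lt_const hε2).and (l2.eventually_lt_const hε2)).exists
  obtain ⟨φ, hφ, a1, a2⟩ := (hw k).approx (ε / 2) hε2.ne'
  have m := hφ.memLp (volume.restrict Ω)
  refine ⟨φ, hφ, ?_, ?_⟩
  · rw [← sub_add_sub_cancel v.1 (w k).1 φ, ← ENNReal.add_halves ε]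
    exact (eLpNorm_add_le (h1.sub (hw k).memLp_fun).1 ((hw k).memLp_fun.sub m.1).1
      (by norm_num)).trans (add_le_add hk1.le a1)
  · rw [← sub_add_sub_cancel v.2 (w k).2 (gradient φ), ← ENNReal.add_halves ε]
    exact (eLpNorm_add_le (h2.sub (hw k).memLp_grad).1 ((hw k).memLp_grad.sub m.2).1
      (by norm_num)).trans (add_le_add hk2.le a2)

/-- A smooth cutoff function that is one in a neighborhood of a compact set. -/
theorem exists_isTest_one_nhds {K : Set (Sp d)} (hΩ : IsOpen Ω) (hK : IsCompact K)
    (hsub : K ⊆ Ω) :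
    ∃ ζ : Sp d → ℝ, IsTest Ω ζ ∧ (∀ x, |ζ x| ≤ 1) ∧ ∀ x ∈ K, ∀ᶠ y in 𝓝 x, ζ y = 1 := by
  obtain ⟨K', hK', h1, h2⟩ := exists_compact_between hK hΩ hsub
  obtain ⟨f, hf1, hf0, hf⟩ := exists_contMDiffMap_one_nhds_of_subset_interior (n := ⊤)
    𝓘(ℝ, Sp d) hK.isClosed h1
  have hts : tsupport f ⊆ K' := by
    refine closure_minimal (fun x hx => ?_) hK'.isClosed
    by_contra h
    exact hx (hf0 x h)
  refine ⟨f, ⟨f.contMDiff.contDiff, ?_, hts.trans h2⟩, fun x => ?_, fun x hx => ?_⟩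
  · exact hK'.of_isClosed_subset (isClosed_tsupport f) hts
  · rw [abs_le]
    exact ⟨by linarith [(hf x).1], (hf x).2⟩
  · exact hf1.filter_mono (nhds_le_nhdsSet hx)

/-- The weak gradient vanishes where the function vanishes, off a compact set. -/
theorem MemH1.grad_eq_cutoff_smul {g : GFun d} {K : Set (Sp d)} {ζ : Sp d → ℝ} (hΩ : IsOpen Ω)
    (hg : MemH1 Ω g) (h0 : ∀ x ∈ Ω \ K, g.1 x = 0) (hζ : IsTest Ω ζ)
    (hζK : ∀ x ∈ K, ∀ᶠ y in 𝓝 x, ζ y = 1) :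
    ∀ᵐ x ∂volume.restrict Ω, g.2 x = ζ x • g.2 x := by
  obtain ⟨c, hc⟩ := hζ.smooth.continuous.bounded_above_of_compact_support hζ.compact
  have hm : MemLp (fun x => g.2 x - ζ x • g.2 x) 2 (volume.restrict Ω) :=
    hg.memLp_grad.sub (memLp_smul_of_bound hζ.smooth.continuous.aestronglyMeasurable
      (Eventually.of_forall hc) hg.memLp_grad)
  have key := hΩ.ae_eq_zero_of_integral_contDiff_smul_eq_zero (μ := volume)
    (f := fun x => g.2 x - ζ x • g.2 x)
    (locallyIntegrableOn_of_locallyIntegrable_restrict (hm.locallyIntegrable (by norm_num))) ?_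
  · rw [ae_restrict_iff' hΩ.measurableSet]
    filter_upwards [key] with x hx hxΩ
    exact sub_eq_zero.1 (hx hxΩ)
  · intro ψ hψ hψc hψs
    rw [← setIntegral_eq_integral_of_forall_compl_eq_zero (s := Ω) fun x hx => by
      rw [image_eq_zero_of_notMem_tsupport fun h => hx (hψs h), zero_smul]]
    refine ext_inner_right ℝ fun e => ?_
    have hψt : IsTest Ω ψ := ⟨hψ, hψc, hψs⟩
    have hi : Integrable (fun x => ψ x • (g.2 x - ζ x • g.2 x)) (volume.restrict Ω) := by
      rw [← memLp_one_iff_integrable]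
      exact hm.smul (hψt.memLp (volume.restrict Ω)).1
    rw [inner_zero_left, real_inner_comm, ← integral_inner hi]
    -- The test function `(1 - ζ)ψ` vanishes near `K`, and `g` vanishes off `K`, so the left side of
    -- the weak identity is zero. What remains says that `(1 - ζ) ∇g` is orthogonal to every `ψ`.
    have ht : IsTest Ω (fun x => ψ x - ζ x * ψ x) := by
      refine ⟨hψ.sub (hζ.smooth.mul hψ), hψc.sub hψc.mul_left, ?_⟩
      refine (tsupport_sub _ _).trans (Set.union_subset hψs ?_)
      exact (tsupport_mul_subset_right).trans hψs
    have hw := hg.weak _ ht e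
    have hz : ∫ x in Ω, g.1 x * fderiv ℝ (fun x => ψ x - ζ x * ψ x) x e = 0 := by
      refine integral_eq_zero_of_ae ?_
      filter_upwards [ae_restrict_mem hΩ.measurableSet] with x hx
      by_cases hxK : x ∈ K
      · have : (fun x => ψ x - ζ x * ψ x) =ᶠ[𝓝 x] fun _ => 0 := by
          filter_upwards [hζK x hxK] with y hy
          rw [hy]; ring
        rw [this.fderiv_eq]
        simp
      · simp [h0 x ⟨hx, hxK⟩]
    rw [hz] at hw
    rw [← neg_eq_zero, hw]
    congr 1
    refine integral_congr_ae (Eventually.of_forall fun x => ?_)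
    simp only [real_inner_smul_right, inner_sub_right, real_inner_comm e]
    ring

/-- A function in `H¹(Ω)` with compact support in `Ω`, extended by zero, has a weak gradient in
the whole space. -/
theorem MemH1.integral_mul_fderiv_of_compact {g : GFun d} {K : Set (Sp d)} {ζ φ : Sp d → ℝ}
    (hΩ : IsOpen Ω) (hg : MemH1 Ω g) (h0 : ∀ x ∈ Ω \ K, g.1 x = 0) (hζ : IsTest Ω ζ)
    (hζK : ∀ x ∈ K, ∀ᶠ y in 𝓝 x, ζ y = 1) (hφ : ContDiff ℝ ∞ φ) (e : Sp d) :
    ∫ x in Ω, g.1 x * fderiv ℝ φ x e = - ∫ x in Ω, ⟪ζ x • g.2 x, e⟫ * φ x := by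
  -- The function `φ` need not have compact support, but `ζφ` does, and the two agree near `K`, the
  -- only place where `g` can be nonzero.
  have ht : IsTest Ω (fun x => ζ x * φ x) :=
    ⟨hζ.smooth.mul hφ, hζ.compact.mul_right, (tsupport_mul_subset_left).trans hζ.subset⟩
  have hw := hg.weak _ ht e
  have h1 : ∫ x in Ω, g.1 x * fderiv ℝ (fun x => ζ x * φ x) x e =
      ∫ x in Ω, g.1 x * fderiv ℝ φ x e := by
    refine setIntegral_congr_fun hΩ.measurableSet fun x hx => ?_
    by_cases hxK : x ∈ K
    · have : (fun x => ζ x * φ x) =ᶠ[𝓝 x] φ := by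
        filter_upwards [hζK x hxK] with y hy
        rw [hy, one_mul]
      simp only [this.fderiv_eq]
    · simp [h0 x ⟨hx, hxK⟩]
  rw [← h1, hw]
  congr 1
  refine integral_congr_ae (Eventually.of_forall fun x => ?_)
  simp only [real_inner_smul_left]
  ring

/-- A function in `H¹(Ω)` with compact support in `Ω` is in `H¹₀(Ω)`. -/
theorem MemH1.memH10_of_compact {g : GFun d} {K : Set (Sp d)} (hΩ : IsOpen Ω) (hg : MemH1 Ω g)
    (hK : IsCompact K) (hsub : K ⊆ Ω) (h0 : ∀ x ∈ Ω \ K, g.1 x = 0) : MemH10 Ω g := by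
  refine ⟨hg.memLp_fun, hg.memLp_grad, fun ε hε => ?_⟩
  obtain ⟨ζ, hζ, hζ1, hζK⟩ := exists_isTest_one_nhds hΩ hK hsub
  set g₁ : Sp d → ℝ := Ω.indicator g.1 with hg₁
  -- With the factor `ζ` the whole-space identity holds for every smooth `φ`. The factor disappears
  -- at the end, since `g.2 = ζ • g.2` almost everywhere in Ω.
  set g₂ : Sp d → Sp d := Ω.indicator fun x => ζ x • g.2 x with hg₂
  have m₁ : MemLp g₁ 2 volume := (memLp_indicator_iff_restrict hΩ.measurableSet).2 hg.memLp_fun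
  have m₂ : MemLp g₂ 2 volume := (memLp_indicator_iff_restrict hΩ.measurableSet).2
    (memLp_smul_of_bound hζ.smooth.continuous.aestronglyMeasurable
      (Eventually.of_forall hζ1) hg.memLp_grad)
  have hweak (φ : Sp d → ℝ) (hφ : ContDiff ℝ ∞ φ) (e : Sp d) :
      ∫ x, g₁ x * fderiv ℝ φ x e = - ∫ x, ⟪g₂ x, e⟫ * φ x := by
    have := hg.integral_mul_fderiv_of_compact hΩ h0 hζ hζK hφ e
    have e1 : ∫ x, g₁ x * fderiv ℝ φ x e = ∫ x in Ω, g.1 x * fderiv ℝ φ x e := by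
      rw [← setIntegral_eq_integral_of_forall_compl_eq_zero (s := Ω) fun x hx => by
        rw [hg₁, Set.indicator_of_notMem hx, zero_mul]]
      exact setIntegral_congr_fun hΩ.measurableSet fun x hx => by simp [hg₁, hx]
    have e2 : ∫ x, ⟪g₂ x, e⟫ * φ x = ∫ x in Ω, ⟪ζ x • g.2 x, e⟫ * φ x := by
      rw [← setIntegral_eq_integral_of_forall_compl_eq_zero (s := Ω) fun x hx => by
        rw [hg₂, Set.indicator_of_notMem hx, inner_zero_left, zero_mul]]
      exact setIntegral_congr_fun hΩ.measurableSet fun x hx => by simp [hg₂, hx]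
    rw [e1, e2, this]
  obtain ⟨δ₁, hδ₁, H₁⟩ := exists_eLpNorm_bump_convolution_sub_le m₁ hε
  obtain ⟨δ₂, hδ₂, H₂⟩ := exists_eLpNorm_bump_convolution_sub_le m₂ hε
  obtain ⟨δ₃, hδ₃, H₃⟩ := hK.exists_cthickening_subset_open hΩ hsub
  -- The first two radii control the L² errors of the function and of its gradient; the third keeps
  -- the support of the mollification inside Ω.
  have hδ : 0 < min δ₁ (min δ₂ δ₃) := by positivity
  set δ := min δ₁ (min δ₂ δ₃) with hδdef
  let β : ContDiffBump (0 : Sp d) := ⟨δ / 2, δ, by positivity, by linarith⟩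
  set ρ := β.normed volume with hρ
  have hρc : HasCompactSupport ρ := β.hasCompactSupport_normed
  have hρs : ContDiff ℝ ∞ ρ := β.contDiff_normed
  have l₁ : LocallyIntegrable g₁ volume := m₁.locallyIntegrable (by norm_num)
  have l₂ : LocallyIntegrable g₂ volume := m₂.locallyIntegrable (by norm_num)
  set T₁ := ρ ⋆[ContinuousLinearMap.lsmul ℝ ℝ, volume] g₁ with hT₁
  set T₂ := ρ ⋆[ContinuousLinearMap.lsmul ℝ ℝ, volume] g₂ with hT₂
  have hsuppg : Function.support g₁ ⊆ K := by
    intro x hx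
    by_contra hxK
    refine hx ?_
    by_cases hxΩ : x ∈ Ω
    · simp [hg₁, hxΩ, h0 x ⟨hxΩ, hxK⟩]
    · simp [hg₁, hxΩ]
  have hgc : HasCompactSupport g₁ :=
    hK.of_isClosed_subset (isClosed_tsupport _) (closure_minimal hsuppg hK.isClosed)
  have hT₁s : tsupport T₁ ⊆ Ω := by
    refine subset_trans (closure_minimal ?_ Metric.isClosed_cthickening) H₃
    refine (support_convolution_subset _).trans ?_
    rintro x ⟨y, hy, z, hz, rfl⟩
    rw [hρ, β.support_normed_eq] at hy
    refine Metric.mem_cthickening_of_dist_le _ z _ _ (hsuppg hz) ?_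
    simp only [dist_eq_norm, add_sub_cancel_right]
    exact (mem_ball_zero_iff.1 hy).le.trans ((min_le_right _ _).trans (min_le_right _ _))
  have htest : IsTest Ω T₁ :=
    ⟨hρc.contDiff_convolution_left _ hρs l₁, hρc.convolution _ hgc, hT₁s⟩
  -- The derivative falls on the kernel. The reflected and translated kernel is then used as the
  -- smooth function in `hweak`, which moves the derivative onto `g₁`.
  have hgrad : gradient T₁ = T₂ := by
    ext1 x
    refine ext_inner_right ℝ fun e => ?_
    have hflip : T₁ = g₁ ⋆[ContinuousLinearMap.lsmul ℝ ℝ, volume] ρ := by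
      ext1 y
      rw [hT₁, convolution_lsmul_swap, convolution_def]
      simp [mul_comm]
    have hd := hρc.hasFDerivAt_convolution_right (ContinuousLinearMap.lsmul ℝ ℝ) l₁
      (hρs.of_le (by simp)) x
    rw [inner_gradient_left, hflip, hd.fderiv,
      convolution_precompR_apply _ l₁ (hρc.fderiv ℝ) (hρs.continuous_fderiv (by simp))]
    have hshift : ContDiff ℝ ∞ fun t => ρ (x - t) := hρs.comp (contDiff_const.sub contDiff_id)
    have hder (t : Sp d) : fderiv ℝ (fun t => ρ (x - t)) t e = - fderiv ℝ ρ (x - t) e := by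
      have h1 : HasFDerivAt (fun t => x - t) (-ContinuousLinearMap.id ℝ (Sp d)) t :=
        (hasFDerivAt_id t).const_sub x
      have h2 : HasFDerivAt ρ (fderiv ℝ ρ (x - t)) (x - t) :=
        (hρs.differentiable (by simp) _).hasFDerivAt
      have h3 : HasFDerivAt (fun t => ρ (x - t)) _ t := h2.comp t h1
      rw [h3.fderiv]
      simp
    have hw := hweak _ hshift e
    simp_rw [hder, mul_neg, integral_neg, neg_inj] at hw
    rw [convolution_def]
    simp only [ContinuousLinearMap.lsmul_apply, smul_eq_mul]
    rw [hw, hT₂, convolution_lsmul_swap, real_inner_comm]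
    have hi : Integrable (fun t => ρ (x - t) • g₂ t) volume :=
      l₂.integrable_smul_left_of_hasCompactSupport hshift.continuous
        (hρc.comp_homeomorph (Homeomorph.subLeft x))
    rw [← integral_inner hi]
    refine integral_congr_ae (Eventually.of_forall fun t => ?_)
    simp only [real_inner_smul_right, real_inner_comm e]
    ring
  refine ⟨T₁, htest, ?_, ?_⟩
  · rw [eLpNorm_sub_comm]
    refine le_trans (le_of_eq ?_) ((eLpNorm_mono_measure _ (Measure.restrict_le_self (s := Ω))).trans
      (H₁ β (min_le_left _ _)))
    refine eLpNorm_congr_ae ?_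
    filter_upwards [ae_restrict_mem hΩ.measurableSet] with x hx
    simp [hT₁, hg₁, hx, hρ]
  · rw [eLpNorm_sub_comm, hgrad]
    refine le_trans (le_of_eq ?_) ((eLpNorm_mono_measure _ (Measure.restrict_le_self (s := Ω))).trans
      (H₂ β ((min_le_right _ _).trans (min_le_left _ _))))
    refine eLpNorm_congr_ae ?_
    filter_upwards [ae_restrict_mem hΩ.measurableSet,
      hg.grad_eq_cutoff_smul hΩ h0 hζ hζK] with x hx hx2
    simp only [Pi.sub_apply, hT₂, hg₂, Set.indicator_of_mem hx, ← hx2, hρ]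

/-- A function in `H¹(Ω)` that vanishes on `∂Ω` is in `H¹₀(Ω)`. -/
theorem ZeroOnBoundary.memH10 {v : GFun d} (hΩ : IsOpen Ω) (h : ZeroOnBoundary Ω Ω v) :
    MemH10 Ω v := by
  obtain ⟨hv, w, hw, l1, l2⟩ := h
  refine MemH10.of_tendsto hv.memLp_fun hv.memLp_grad (fun k => ?_) l1 l2
  obtain ⟨h1, K, hK, hsub, h0⟩ := hw k
  exact h1.memH10_of_compact hΩ hK hsub h0

/-- Extension by zero maps `H¹₀(Ω)` into `H¹₀(D)` for a larger set `D`. -/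
theorem MemH10.extend {v : GFun d} (hΩ : MeasurableSet Ω) (hD : MeasurableSet D) (hsub : Ω ⊆ D)
    (h : MemH10 Ω v) (h1 : ∀ x ∈ D \ Ω, v.1 x = 0) (h2 : ∀ x ∈ D \ Ω, v.2 x = 0) :
    MemH10 D v := by
  have ae {F : Type} [NormedAddCommGroup F] (a : Sp d → F) (ha : ∀ x ∈ D \ Ω, a x = 0) :
      Ω.indicator a =ᵐ[volume.restrict D] a := by
    filter_upwards [ae_restrict_mem hD] with x hx
    by_cases hxΩ : x ∈ Ω
    · simp [hxΩ]
    · simp [hxΩ, ha x ⟨hx, hxΩ⟩]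
  have m1 {F : Type} [NormedAddCommGroup F] (a : Sp d → F) (ha : ∀ x ∈ D \ Ω, a x = 0)
      (hm : MemLp a 2 (volume.restrict Ω)) : MemLp a 2 (volume.restrict D) := by
    refine MemLp.ae_eq (ae a ha) ?_
    rw [memLp_indicator_iff_restrict hΩ, Measure.restrict_restrict_of_subset hsub]
    exact hm
  have e1 {F : Type} [NormedAddCommGroup F] (a : Sp d → F) (ha : ∀ x ∈ D \ Ω, a x = 0) :
      eLpNorm a 2 (volume.restrict D) = eLpNorm a 2 (volume.restrict Ω) := by
    rw [← eLpNorm_congr_ae (ae a ha), eLpNorm_indicator_eq_eLpNorm_restrict hΩ,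
      Measure.restrict_restrict_of_subset hsub]
  refine ⟨m1 _ h1 h.memLp_fun, m1 _ h2 h.memLp_grad, fun ε hε => ?_⟩
  obtain ⟨φ, hφ, l1, l2⟩ := h.approx ε hε
  refine ⟨φ, hφ.mono hsub, ?_, ?_⟩
  · rwa [e1 _ fun x hx => ?_]
    rw [Pi.sub_apply, h1 x hx, hφ.eq_zero hx.2, sub_zero]
  · rwa [e1 _ fun x hx => ?_]
    rw [Pi.sub_apply, h2 x hx,
      gradient_eq_zero_of_notMem_tsupport fun h => hx.2 (hφ.subset h), sub_zero]

theorem MemH10.zeroOnBoundary {v : GFun d} (h : MemH10 D v) : ZeroOnBoundary D D v := by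
  obtain ⟨φ, hφ, l1, l2⟩ := h.exists_seq
  exact ⟨h.memH1, fun k => (φ k, gradient (φ k)), fun k => ⟨(hφ k).memH1, tsupport (φ k),
    (hφ k).compact, (hφ k).subset, fun x hx => image_eq_zero_of_notMem_tsupport hx.2⟩, l1, l2⟩

/-- The values of a pair outside Ω carry no meaning. The competitor in the main proof agrees with a
known element of H¹₀(D) only on D, where the cutoffs add up to one. -/
theorem MemH10.congr {v w : GFun d} (hv : MemH10 Ω v)
    (h1 : v.1 =ᵐ[volume.restrict Ω] w.1) (h2 : v.2 =ᵐ[volume.restrict Ω] w.2) :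
    MemH10 Ω w := by
  refine ⟨hv.memLp_fun.ae_eq h1, hv.memLp_grad.ae_eq h2, fun ε hε => ?_⟩
  obtain ⟨φ, hφ, l1, l2⟩ := hv.approx ε hε
  refine ⟨φ, hφ, ?_, ?_⟩
  · rwa [← eLpNorm_congr_ae (h1.sub EventuallyEq.rfl)]
  · rwa [← eLpNorm_congr_ae (h2.sub EventuallyEq.rfl)]

theorem MemH10.sub {v w : GFun d} (hv : MemH10 Ω v) (hw : MemH10 Ω w) : MemH10 Ω (v - w) := by
  refine ⟨hv.memLp_fun.sub hw.memLp_fun, hv.memLp_grad.sub hw.memLp_grad, fun ε hε => ?_⟩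
  have hε2 : ε / 2 ≠ 0 := (ENNReal.half_pos hε).ne'
  obtain ⟨φ, hφ, a1, a2⟩ := hv.approx _ hε2
  obtain ⟨ψ, hψ, b1, b2⟩ := hw.approx _ hε2
  obtain ⟨m1, m2⟩ := hφ.memLp (volume.restrict Ω)
  obtain ⟨n1, n2⟩ := hψ.memLp (volume.restrict Ω)
  have hgrad : gradient (φ - ψ) = gradient φ - gradient ψ := by
    ext1 x
    refine ext_inner_right ℝ fun e => ?_
    rw [inner_gradient_left, fderiv_sub (hφ.differentiable x) (hψ.differentiable x)]
    simp [inner_sub_left, inner_gradient_left]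
  refine ⟨φ - ψ, ⟨hφ.smooth.sub hψ.smooth, hφ.compact.sub hψ.compact,
    (tsupport_sub _ _).trans (Set.union_subset hφ.subset hψ.subset)⟩, ?_, ?_⟩
  · rw [Prod.fst_sub, sub_sub_sub_comm, ← ENNReal.add_halves ε]
    exact (eLpNorm_sub_le (hv.memLp_fun.sub m1).1 (hw.memLp_fun.sub n1).1 (by norm_num)).trans
      (add_le_add a1 b1)
  · rw [Prod.snd_sub, hgrad, sub_sub_sub_comm, ← ENNReal.add_halves ε]
    exact (eLpNorm_sub_le (hv.memLp_grad.sub m2).1 (hw.memLp_grad.sub n2).1 (by norm_num)).trans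
      (add_le_add a2 b2)

theorem MemH10.sub_sum {ι : Type*} (s : Finset ι) {v : GFun d} {w : ι → GFun d}
    (hv : MemH10 Ω v) (h : ∀ i ∈ s, MemH10 Ω (w i)) : MemH10 Ω (v - ∑ i ∈ s, w i) := by
  classical
  induction s using Finset.induction_on with
  | empty => simpa using hv
  | insert a s ha ih =>
    rw [Finset.sum_insert ha, add_comm, ← sub_sub]
    exact (ih fun i hi => h i (Finset.mem_insert_of_mem hi)).sub (h a (Finset.mem_insert_self a s))

end Density

/-! ### Products with Lipschitz functions, and cutoffs into H¹₀. -/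

section Product

variable {d : ℕ} {Ω D : Set (Sp d)}

/-- The factor `η` may be unbounded, but `η x (φ x - φ y) + (η x - η y) φ y` needs a bound for it
only at `x`. By symmetry `x` may be taken in the compact support of `φ`, unless both products
vanish. -/
theorem exists_lipschitz_mul {η φ : Sp d → ℝ} {K K' : NNReal} (hη : LipschitzWith K η)
    (hφ : LipschitzWith K' φ) (hc : HasCompactSupport φ) :
    ∃ C, LipschitzWith C (fun x => η x * φ x) := by
  obtain ⟨B, hB⟩ := hc.isCompact.exists_bound_of_continuousOn hη.continuous.continuousOn
  obtain ⟨M, hM⟩ := hφ.continuous.bounded_above_of_compact_support hc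
  have hbd : ∀ x ∈ tsupport φ, ∀ y,
      |η x * φ x - η y * φ y| ≤ (|B| * K' + K * |M|) * dist x y := by
    intro x hx y
    have h1 := hη.dist_le_mul x y
    have h2 := hφ.dist_le_mul x y
    rw [Real.dist_eq] at h1 h2
    have h3 : |η x| ≤ |B| := (hB x hx).trans (le_abs_self B)
    have h4 : |φ y| ≤ |M| := (hM y).trans (le_abs_self M)
    calc |η x * φ x - η y * φ y| = |η x * (φ x - φ y) + (η x - η y) * φ y| := by ring_nf
      _ ≤ |η x| * |φ x - φ y| + |η x - η y| * |φ y| := by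
        rw [← abs_mul, ← abs_mul]; exact abs_add_le _ _
      _ ≤ |B| * (K' * dist x y) + K * dist x y * |M| := by gcongr
      _ = _ := by ring
  refine ⟨⟨|B| * K' + K * |M|, by positivity⟩, LipschitzWith.of_dist_le_mul fun x y => ?_⟩
  rw [Real.dist_eq]
  by_cases hx : x ∈ tsupport φ
  · exact hbd x hx y
  by_cases hy : y ∈ tsupport φ
  · rw [abs_sub_comm, dist_comm]
    exact hbd y hy x
  · rw [image_eq_zero_of_notMem_tsupport hx, image_eq_zero_of_notMem_tsupport hy]
    simp only [mul_zero, sub_zero, abs_zero]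
    exact mul_nonneg (NNReal.coe_nonneg _) dist_nonneg

/-- The weak derivative may be tested with compactly supported Lipschitz functions. -/
theorem MemH1.weak_lipschitz {w : GFun d} (hΩ : IsOpen Ω) (hw : MemH1 Ω w) {g : Sp d → ℝ}
    {K : NNReal} (hg : LipschitzWith K g) (hc : HasCompactSupport g) (hsub : tsupport g ⊆ Ω)
    (e : Sp d) : ∫ x in Ω, w.1 x * fderiv ℝ g x e = - ∫ x in Ω, ⟪w.2 x, e⟫ * g x := by
  have h10 : MemH10 Ω (g, gradient g) :=
    (memH1_of_lipschitz_compact hg hc).memH10_of_compact hΩ hc.isCompact hsub fun x hx =>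
      image_eq_zero_of_notMem_tsupport hx.2
  obtain ⟨φ, hφ, l1, l2⟩ := h10.exists_seq
  have hwe : MemLp (fun x => w.1 x • e) 2 (volume.restrict Ω) :=
    hw.memLp_fun.of_le_mul (c := ‖e‖) (hw.memLp_fun.1.smul_const e)
      (Eventually.of_forall fun x => by rw [norm_smul, mul_comm])
  have t1 := tendsto_integral_inner hwe h10.memLp_grad
    (fun k => ((hφ k).memLp (volume.restrict Ω)).2) l2
  have t2 := tendsto_integral_mul (hw.memLp_grad.inner_const e) h10.memLp_fun
    (fun k => ((hφ k).memLp (volume.restrict Ω)).1) l1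
  have hin (x : Sp d) (f : Sp d → ℝ) : ⟪w.1 x • e, gradient f x⟫ = w.1 x * fderiv ℝ f x e := by
    rw [real_inner_smul_left, real_inner_comm, inner_gradient_left]
  simp_rw [hin, (hw.weak _ (hφ _) e)] at t1
  exact tendsto_nhds_unique t1 t2.neg

/-- Multiplication of a function and its gradient by a Lipschitz function. -/
noncomputable def lipMul (η : Sp d → ℝ) (w : GFun d) : GFun d :=
  (fun x => η x * w.1 x, fun x => η x • w.2 x + w.1 x • gradient η x)

theorem exists_bound_of_lipschitz {η : Sp d → ℝ} {K : NNReal} (hη : LipschitzWith K η)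
    (hb : Bornology.IsBounded Ω) : ∃ c, ∀ x ∈ Ω, |η x| ≤ c := by
  obtain ⟨c, hc⟩ := hb.isCompact_closure.exists_bound_of_continuousOn hη.continuous.continuousOn
  exact ⟨c, fun x hx => hc x (subset_closure hx)⟩

theorem memLp_smul_gradient {η : Sp d → ℝ} {K : NNReal} (hη : LipschitzWith K η)
    {μ : Measure (Sp d)} {w : Sp d → ℝ} (hw : MemLp w 2 μ) :
    MemLp (fun x => w x • gradient η x) 2 μ := by
  refine hw.of_le_mul (c := K) (hw.1.smul (measurable_gradient η).aestronglyMeasurable) ?_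
  refine Eventually.of_forall fun x => ?_
  rw [norm_smul, mul_comm]
  gcongr
  exact norm_gradient_le hη x

theorem memLp_lipMul {η : Sp d → ℝ} {K : NNReal} (hη : LipschitzWith K η) (hΩ : MeasurableSet Ω)
    (hb : Bornology.IsBounded Ω) {w : GFun d} (h1 : MemLp w.1 2 (volume.restrict Ω))
    (h2 : MemLp w.2 2 (volume.restrict Ω)) :
    MemLp (lipMul η w).1 2 (volume.restrict Ω) ∧ MemLp (lipMul η w).2 2 (volume.restrict Ω) := by
  obtain ⟨c, hc⟩ := exists_bound_of_lipschitz hη hb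
  have hc' : ∀ᵐ x ∂volume.restrict Ω, ‖η x‖ ≤ c := by
    filter_upwards [ae_restrict_mem hΩ] with x hx using hc x hx
  have hm := hη.continuous.aestronglyMeasurable (μ := volume.restrict Ω)
  exact ⟨memLp_smul_of_bound hm hc' h1,
    (memLp_smul_of_bound hm hc' h2).add (memLp_smul_gradient hη h1)⟩

/-- The product of a Lipschitz function with a function in `H¹(Ω)`. -/
theorem MemH1.lipMul {η : Sp d → ℝ} {K : NNReal} {w : GFun d} (hw : MemH1 Ω w)
    (hη : LipschitzWith K η) (hΩ : IsOpen Ω) (hb : Bornology.IsBounded Ω) :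
    MemH1 Ω (lipMul η w) := by
  obtain ⟨m1, m2⟩ := memLp_lipMul hη hΩ.measurableSet hb hw.memLp_fun hw.memLp_grad
  refine ⟨m1, m2, fun φ hφ e => ?_⟩
  obtain ⟨K', hK'⟩ := hφ.exists_lipschitz
  obtain ⟨C, hC⟩ := exists_lipschitz_mul hη hK' hφ.compact
  -- The product `ηφ` is only Lipschitz, hence the need for the larger class of test functions. The
  -- product rule then splits off the term with `∇η`.
  have h := hw.weak_lipschitz hΩ hC hφ.compact.mul_left
    ((tsupport_mul_subset_right).trans hφ.subset) e
  have i1 : Integrable (fun x => η x * w.1 x * fderiv ℝ φ x e) (volume.restrict Ω) :=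
    m1.integrable_mul (hφ.memLp_fderiv (volume.restrict Ω) e)
  have i2 : Integrable (fun x => ⟪w.1 x • gradient η x, e⟫ * φ x) (volume.restrict Ω) :=
    ((memLp_smul_gradient hη hw.memLp_fun).inner_const e).integrable_mul
      (hφ.memLp (volume.restrict Ω)).1
  have i3 : Integrable (fun x => ⟪(GMsFEM.lipMul η w).2 x, e⟫ * φ x) (volume.restrict Ω) :=
    (m2.inner_const e).integrable_mul (hφ.memLp (volume.restrict Ω)).1
  have e1 : ∫ x in Ω, w.1 x * fderiv ℝ (fun x => η x * φ x) x e =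
      ∫ x in Ω, (η x * w.1 x * fderiv ℝ φ x e + ⟪w.1 x • gradient η x, e⟫ * φ x) := by
    refine integral_congr_ae ?_
    filter_upwards [ae_restrict_of_ae (hη.ae_differentiableAt (μ := volume))] with x hx
    rw [fderiv_fun_mul hx (hφ.differentiable x)]
    simp only [add_apply, smul_apply, smul_eq_mul,
      real_inner_smul_left, inner_gradient_left]
    ring
  have e2 : ∫ x in Ω, ⟪w.2 x, e⟫ * (η x * φ x) =
      ∫ x in Ω, (⟪(GMsFEM.lipMul η w).2 x, e⟫ * φ x - ⟪w.1 x • gradient η x, e⟫ * φ x) := by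
    refine integral_congr_ae (Eventually.of_forall fun x => ?_)
    simp only [GMsFEM.lipMul, inner_add_left, real_inner_smul_left]
    ring
  rw [e1, e2, integral_add i1 i2, integral_sub i3 i2] at h
  change ∫ x in Ω, η x * w.1 x * fderiv ℝ φ x e = _
  linarith

theorem lipMul_sub (η : Sp d → ℝ) (v w : GFun d) : lipMul η (v - w) = lipMul η v - lipMul η w := by
  ext1
  · ext1 x
    simp [lipMul, mul_sub]
  · ext1 x
    simp only [lipMul, Prod.snd_sub, Prod.fst_sub, Pi.sub_apply, smul_sub, sub_smul]
    abel

/-- Multiplication by a Lipschitz function is continuous in `H¹(Ω)`. -/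
theorem tendsto_lipMul {η : Sp d → ℝ} {K : NNReal} (hη : LipschitzWith K η)
    (hΩ : MeasurableSet Ω) (hb : Bornology.IsBounded Ω) {v : GFun d} {w : ℕ → GFun d}
    (h1 : MemLp v.1 2 (volume.restrict Ω)) (h2 : MemLp v.2 2 (volume.restrict Ω))
    (hw : ∀ k, MemH1 Ω (w k))
    (l1 : Tendsto (fun k => eLpNorm (v.1 - (w k).1) 2 (volume.restrict Ω)) atTop (𝓝 0))
    (l2 : Tendsto (fun k => eLpNorm (v.2 - (w k).2) 2 (volume.restrict Ω)) atTop (𝓝 0)) :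
    Tendsto (fun k => eLpNorm ((lipMul η v).1 - (lipMul η (w k)).1) 2 (volume.restrict Ω))
      atTop (𝓝 0) ∧
    Tendsto (fun k => eLpNorm ((lipMul η v).2 - (lipMul η (w k)).2) 2 (volume.restrict Ω))
      atTop (𝓝 0) := by
  obtain ⟨c, hc⟩ := exists_bound_of_lipschitz hη hb
  have b1 {F : Type} [NormedAddCommGroup F] [NormedSpace ℝ F] (g : Sp d → F) :
      eLpNorm (fun x => η x • g x) 2 (volume.restrict Ω) ≤
        ENNReal.ofReal c * eLpNorm g 2 (volume.restrict Ω) := by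
    refine eLpNorm_le_mul_eLpNorm_of_ae_le_mul ?_ 2
    filter_upwards [ae_restrict_mem hΩ] with x hx
    rw [norm_smul]
    gcongr
    exact hc x hx
  have b2 (g : Sp d → ℝ) : eLpNorm (fun x => g x • gradient η x) 2 (volume.restrict Ω) ≤
      ENNReal.ofReal K * eLpNorm g 2 (volume.restrict Ω) := by
    refine eLpNorm_le_mul_eLpNorm_of_ae_le_mul (Eventually.of_forall fun x => ?_) 2
    rw [norm_smul, mul_comm]
    gcongr
    exact norm_gradient_le hη x
  have t {a : ℝ} {s : ℕ → ENNReal} (hs : Tendsto s atTop (𝓝 0)) :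
      Tendsto (fun k => ENNReal.ofReal a * s k) atTop (𝓝 0) := by
    simpa using ENNReal.Tendsto.const_mul hs (Or.inr ENNReal.ofReal_ne_top)
  constructor
  · refine tendsto_of_tendsto_of_tendsto_of_le_of_le tendsto_const_nhds (t (a := c) l1)
      (fun _ => zero_le) fun k => ?_
    rw [← Prod.fst_sub, ← lipMul_sub]
    exact b1 _
  · have ht := (t (a := c) l2).add (t (a := K) l1)
    rw [add_zero] at ht
    refine tendsto_of_tendsto_of_tendsto_of_le_of_le tendsto_const_nhds ht
      (fun _ => zero_le) fun k => ?_
    rw [← Prod.snd_sub, ← lipMul_sub]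
    refine (eLpNorm_add_le ?_ ?_ (by norm_num)).trans (add_le_add (b1 _) (b2 _))
    · exact hη.continuous.aestronglyMeasurable.smul (h2.sub (hw k).memLp_grad).1
    · exact (memLp_smul_gradient hη (h1.sub (hw k).memLp_fun)).1

/-- The product of a Lipschitz function with a function in `H¹₀(Ω)`. -/
theorem MemH10.lipMul {η : Sp d → ℝ} {K : NNReal} {w : GFun d} (hw : MemH10 Ω w)
    (hη : LipschitzWith K η) (hΩ : IsOpen Ω) (hb : Bornology.IsBounded Ω) :
    MemH10 Ω (lipMul η w) := by
  obtain ⟨φ, hφ, l1, l2⟩ := hw.exists_seq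
  obtain ⟨m1, m2⟩ := memLp_lipMul hη hΩ.measurableSet hb hw.memLp_fun hw.memLp_grad
  obtain ⟨t1, t2⟩ := tendsto_lipMul (w := fun k => (φ k, gradient (φ k))) hη hΩ.measurableSet hb
    hw.memLp_fun hw.memLp_grad (fun k => (hφ k).memH1) l1 l2
  refine MemH10.of_tendsto m1 m2 (fun k => ?_) t1 t2
  refine ((hφ k).memH1.lipMul hη hΩ hb).memH10_of_compact hΩ (hφ k).compact (hφ k).subset
    fun x hx => ?_
  simp [GMsFEM.lipMul, image_eq_zero_of_notMem_tsupport hx.2]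

/-- Multiplication by a Lipschitz function, with the gradient set to zero where that function
vanishes. -/
noncomputable def cutoffMul (η : Sp d → ℝ) (w : GFun d) : GFun d :=
  ((lipMul η w).1, {x | η x ≠ 0}.indicator (lipMul η w).2)

/-- The soft truncation of a function at the height `ε`. -/
noncomputable def softTrunc (ε : ℝ) (η : Sp d → ℝ) : Sp d → ℝ :=
  fun x => max (η x - ε) 0 + min (η x + ε) 0

theorem lipschitz_softTrunc {η : Sp d → ℝ} {K : NNReal} (hη : LipschitzWith K η) (ε : ℝ) :
    LipschitzWith (K + K) (softTrunc ε η) := by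
  have h1 := (hη.sub (LipschitzWith.const ε)).max_const 0
  have h2 := (hη.add (LipschitzWith.const ε)).min_const 0
  rw [add_zero] at h1 h2
  exact h1.add h2

theorem softTrunc_eq_zero {η : Sp d → ℝ} {ε : ℝ} {x : Sp d} (h : |η x| ≤ ε) :
    softTrunc ε η x = 0 := by
  rw [abs_le] at h
  rw [softTrunc, max_eq_right (by linarith), min_eq_right (by linarith), add_zero]

theorem abs_softTrunc_sub_le {η : Sp d → ℝ} {ε : ℝ} (hε : 0 ≤ ε) (x : Sp d) :
    |softTrunc ε η x - η x| ≤ ε := by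
  rw [softTrunc, abs_le]
  rcases max_cases (η x - ε) 0 with h | h <;> rcases min_cases (η x + ε) 0 with h' | h' <;>
    constructor <;> linarith

/-- Near such a point the truncation is `η` shifted by a constant. -/
theorem gradient_softTrunc_of_lt {η : Sp d → ℝ} (hη : Continuous η) {ε : ℝ} (hε : 0 ≤ ε)
    {x : Sp d} (h : ε < |η x|) : gradient (softTrunc ε η) x = gradient η x := by
  rcases lt_abs.1 h with h | h
  · have : softTrunc ε η =ᶠ[𝓝 x] fun y => η y - ε := by
      filter_upwards [hη.continuousAt.eventually_const_lt h] with y hy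
      rw [softTrunc, max_eq_left (by linarith), min_eq_right (by linarith), add_zero]
    rw [this.gradient_eq, gradient, gradient, fderiv_sub_const]
  · have : softTrunc ε η =ᶠ[𝓝 x] fun y => η y + ε := by
      filter_upwards [hη.neg.continuousAt.eventually_const_lt h] with y hy
      rw [Pi.neg_apply] at hy
      rw [softTrunc, max_eq_right (by linarith), min_eq_left (by linarith), zero_add]
    rw [this.gradient_eq, gradient, gradient, fderiv_add_const]

/-- By continuity the truncation is identically zero near a zero of `η`, whatever `η` does there.
This is why products with truncations converge to `cutoffMul`, and it avoids proving that `∇η = 0`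
almost everywhere on `{η = 0}`. -/
theorem gradient_softTrunc_of_eq_zero {η : Sp d → ℝ} (hη : Continuous η) {ε : ℝ} (hε : 0 < ε)
    {x : Sp d} (h : η x = 0) : gradient (softTrunc ε η) x = 0 := by
  have : softTrunc ε η =ᶠ[𝓝 x] fun _ => 0 := by
    filter_upwards [hη.abs.continuousAt.eventually_lt_const (by simpa [h] using hε)] with y hy
    exact softTrunc_eq_zero hy.le
  rw [this.gradient_eq, gradient_fun_const]

/-- Dominated convergence in `L²`. -/
theorem tendsto_eLpNorm_zero_of_dominated {F : Type*} [NormedAddCommGroup F]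
    {μ : Measure (Sp d)} {G : ℕ → Sp d → F} {H : Sp d → ℝ} (hG : ∀ k, AEStronglyMeasurable (G k) μ)
    (hH : MemLp H 2 μ) (hb : ∀ k, ∀ᵐ x ∂μ, ‖G k x‖ ≤ H x)
    (hl : ∀ᵐ x ∂μ, Tendsto (fun k => G k x) atTop (𝓝 0)) :
    Tendsto (fun k => eLpNorm (G k) 2 μ) atTop (𝓝 0) := by
  have hfin : ∫⁻ x, ‖H x‖ₑ ^ (2 : ℝ) ∂μ ≠ ⊤ := by
    have := lintegral_rpow_enorm_lt_top_of_eLpNorm_lt_top (by norm_num) (by norm_num) hH.2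
    simpa using this.ne
  have h := tendsto_lintegral_of_dominated_convergence' (μ := μ)
    (F := fun k x => ‖G k x‖ₑ ^ (2 : ℝ)) (f := fun _ => 0)
    (fun x => ‖H x‖ₑ ^ (2 : ℝ)) (fun k => ((hG k).enorm.pow_const _)) (fun k => ?_) hfin ?_
  · simp only [eLpNorm_eq_lintegral_rpow_enorm_toReal (p := 2) (by norm_num) (by norm_num),
      ENNReal.toReal_ofNat]
    rw [lintegral_zero] at h
    have h2 := (ENNReal.continuous_rpow_const (y := 1 / 2)).tendsto 0 |>.comp h
    simpa [Function.comp_def] using h2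
  · filter_upwards [hb k] with x hx
    refine ENNReal.rpow_le_rpow ?_ (by norm_num)
    rw [← ofReal_norm, ← ofReal_norm]
    exact ENNReal.ofReal_le_ofReal (hx.trans (le_abs_self _))
  · filter_upwards [hl] with x hx
    have h1 : Tendsto (fun k => ‖G k x‖ₑ) atTop (𝓝 0) := by
      simpa using hx.enorm
    have h2 := (ENNReal.continuous_rpow_const (y := 2)).tendsto 0 |>.comp h1
    simpa [Function.comp_def] using h2

/-- A Lipschitz cutoff that vanishes in `D` outside of `Ω` maps functions which vanish near
`∂D` into `H¹₀(Ω)`. -/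
theorem MemH1.cutoffMul_of_compact {η : Sp d → ℝ} {K : NNReal} {w : GFun d} (hw : MemH1 Ω w)
    (hη : LipschitzWith K η) (hΩ : IsOpen Ω) (hb : Bornology.IsBounded Ω)
    (h0 : ∀ x ∈ D \ Ω, η x = 0) {S : Set (Sp d)} (hS : IsCompact S) (hSD : S ⊆ D)
    (hwS : ∀ x ∈ Ω \ S, w.1 x = 0) : MemH10 Ω (cutoffMul η w) := by
  obtain ⟨m1, m2⟩ := memLp_lipMul hη hΩ.measurableSet hb hw.memLp_fun hw.memLp_grad
  have hopen : IsOpen {x | η x ≠ 0} := isOpen_ne_fun hη.continuous continuous_const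
  let ε : ℕ → ℝ := fun k => 1 / ((k : ℝ) + 1)
  have hε (k : ℕ) : 0 < ε k := by positivity
  have hε1 (k : ℕ) : ε k ≤ 1 := by
    simp only [ε]
    rw [div_le_one (by positivity)]
    linarith [(Nat.cast_nonneg k : (0 : ℝ) ≤ k)]
  have hεl : Tendsto ε atTop (𝓝 0) := tendsto_one_div_add_atTop_nhds_zero_nat
  have hL (k : ℕ) := lipschitz_softTrunc hη (ε k)
  have hmem (k : ℕ) : MemH1 Ω (GMsFEM.lipMul (softTrunc (ε k) η) w) := hw.lipMul (hL k) hΩ hb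
  have hm2 : MemLp ({x | η x ≠ 0}.indicator (GMsFEM.lipMul η w).2) 2 (volume.restrict Ω) :=
    m2.indicator hopen.measurableSet
  have hz (k : ℕ) (x : Sp d) (hx : η x = 0) : softTrunc (ε k) η x = 0 :=
    softTrunc_eq_zero (by rw [hx, abs_zero]; exact (hε k).le)
  have hst (x : Sp d) : Tendsto (fun k => softTrunc (ε k) η x) atTop (𝓝 (η x)) := by
    rw [tendsto_iff_dist_tendsto_zero]
    exact squeeze_zero (fun _ => dist_nonneg)
      (fun k => by rw [Real.dist_eq]; exact abs_softTrunc_sub_le (hε k).le x) hεl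
  refine MemH10.of_tendsto (w := fun k => GMsFEM.lipMul (softTrunc (ε k) η) w) m1 hm2
    (fun k => ?_) ?_ ?_
  -- This set is compact and contained in D, and `η` is nonzero on it. Since `η` vanishes on `D \
  -- Ω`, the set lies in Ω, even if `S` does not.
  · refine (hmem k).memH10_of_compact hΩ (K := S ∩ {x | ε k ≤ |η x|})
      (hS.inter_right (isClosed_le continuous_const hη.continuous.abs)) ?_ ?_
    · rintro x ⟨hxS, hx⟩
      by_contra hxΩ
      have : ε k ≤ |η x| := hx
      rw [h0 x ⟨hSD hxS, hxΩ⟩, abs_zero] at this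
      exact absurd this (not_le.2 (hε k))
    · rintro x ⟨hxΩ, hx⟩
      by_cases hxS : x ∈ S
      · have : |η x| < ε k := not_le.1 fun h => hx ⟨hxS, h⟩
        simp [GMsFEM.lipMul, softTrunc_eq_zero this.le]
      · simp [GMsFEM.lipMul, hwS x ⟨hxΩ, hxS⟩]
  · refine tendsto_eLpNorm_zero_of_dominated (fun k => (m1.sub (hmem k).memLp_fun).1)
      hw.memLp_fun.norm (fun k => Eventually.of_forall fun x => ?_)
      (Eventually.of_forall fun x => ?_)
    · simp only [GMsFEM.cutoffMul, GMsFEM.lipMul, Pi.sub_apply]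
      rw [← sub_mul, norm_mul, norm_sub_rev]
      exact mul_le_of_le_one_left (norm_nonneg _)
        ((abs_softTrunc_sub_le (hε k).le x).trans (hε1 k))
    · simp only [GMsFEM.cutoffMul, GMsFEM.lipMul, Pi.sub_apply]
      simpa using (tendsto_const_nhds (x := η x * w.1 x)).sub ((hst x).mul_const (w.1 x))
  · refine tendsto_eLpNorm_zero_of_dominated (fun k => (hm2.sub (hmem k).memLp_grad).1)
      -- The constant is `K` for `∇η` plus `2K` for the truncation, whose Lipschitz constant is
      -- estimated summand by summand. The first term uses `ε k ≤ 1`.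
      (H := fun x => ‖w.2 x‖ + (3 * K) * ‖w.1 x‖)
      (hw.memLp_grad.norm.add (hw.memLp_fun.norm.const_mul _))
      (fun k => Eventually.of_forall fun x => ?_) (Eventually.of_forall fun x => ?_)
    · have hg := norm_gradient_le hη x
      have hg' := norm_gradient_le (hL k) x
      have hK : (0 : ℝ) ≤ K := K.2
      by_cases hx : η x = 0
      · have hn : x ∉ {x | η x ≠ 0} := by simpa using hx
        simp only [GMsFEM.cutoffMul, GMsFEM.lipMul, Pi.sub_apply, Set.indicator_of_notMem hn,
          gradient_softTrunc_of_eq_zero hη.continuous (hε k) hx, hz k x hx]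
        simp only [zero_smul, smul_zero, add_zero, sub_zero, norm_zero]
        positivity
      · have hn : x ∈ {x | η x ≠ 0} := hx
        simp only [GMsFEM.cutoffMul, GMsFEM.lipMul, Pi.sub_apply, Set.indicator_of_mem hn]
        rw [add_sub_add_comm, ← sub_smul, ← smul_sub]
        refine (norm_add_le _ _).trans (add_le_add ?_ ?_)
        · rw [norm_smul, norm_sub_rev]
          exact mul_le_of_le_one_left (norm_nonneg _)
            ((abs_softTrunc_sub_le (hε k).le x).trans (hε1 k))
        · rw [norm_smul, mul_comm]
          gcongr
          refine (norm_sub_le _ _).trans ?_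
          push_cast at hg'
          linarith
    · by_cases hx : η x = 0
      · have hn : x ∉ {x | η x ≠ 0} := by simpa using hx
        refine tendsto_const_nhds.congr fun k => ?_
        simp only [GMsFEM.cutoffMul, GMsFEM.lipMul, Pi.sub_apply, Set.indicator_of_notMem hn,
          gradient_softTrunc_of_eq_zero hη.continuous (hε k) hx, hz k x hx]
        simp
      · have hn : x ∈ {x | η x ≠ 0} := hx
        have hev : ∀ᶠ k in atTop, gradient (softTrunc (ε k) η) x = gradient η x := by
          filter_upwards [hεl.eventually_lt_const (abs_pos.2 hx)] with k hk
          exact gradient_softTrunc_of_lt hη.continuous (hε k).le hk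
        have hlim : Tendsto (fun k => η x • w.2 x + w.1 x • gradient η x -
            (softTrunc (ε k) η x • w.2 x + w.1 x • gradient η x)) atTop (𝓝 0) := by
          have := (tendsto_const_nhds (x := η x • w.2 x + w.1 x • gradient η x)).sub
            (((hst x).smul_const (w.2 x)).add_const (w.1 x • gradient η x))
          simpa using this
        refine hlim.congr' ?_
        filter_upwards [hev] with k hk
        simp only [GMsFEM.cutoffMul, GMsFEM.lipMul, Pi.sub_apply, Set.indicator_of_mem hn, hk]

/-- A Lipschitz cutoff that vanishes in `D` outside of `Ω` maps functions which vanish on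
`∂D ∩ ∂Ω` into `H¹₀(Ω)`. -/
theorem ZeroOnBoundary.cutoffMul {η : Sp d → ℝ} {K : NNReal} {w : GFun d}
    (hw : ZeroOnBoundary D Ω w) (hη : LipschitzWith K η) (hΩ : IsOpen Ω)
    (hb : Bornology.IsBounded Ω) (h0 : ∀ x ∈ D \ Ω, η x = 0) : MemH10 Ω (cutoffMul η w) := by
  obtain ⟨hw1, v, hv, l1, l2⟩ := hw
  have hopen : IsOpen {x | η x ≠ 0} := isOpen_ne_fun hη.continuous continuous_const
  obtain ⟨m1, m2⟩ := memLp_lipMul hη hΩ.measurableSet hb hw1.memLp_fun hw1.memLp_grad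
  obtain ⟨t1, t2⟩ := tendsto_lipMul hη hΩ.measurableSet hb hw1.memLp_fun hw1.memLp_grad
    (fun k => (hv k).1) l1 l2
  refine MemH10.of_tendsto (w := fun k => GMsFEM.cutoffMul η (v k)) m1
    (m2.indicator hopen.measurableSet) (fun k => ?_) t1 ?_
  · obtain ⟨h1, S, hS, hSD, hvS⟩ := hv k
    exact h1.cutoffMul_of_compact hη hΩ hb h0 hS hSD hvS
  · refine tendsto_of_tendsto_of_tendsto_of_le_of_le tendsto_const_nhds t2
      (fun _ => zero_le) fun k => ?_
    -- Both gradients are cut off by the same set `{η ≠ 0}`, so the convergence of the plain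
    -- products suffices.
    change eLpNorm (Set.indicator _ _ - Set.indicator _ _) 2 _ ≤ _
    rw [← Set.indicator_sub']
    exact eLpNorm_indicator_le _

end Product

/-! ### The energy form, weak solutions and Caccioppoli's inequality. -/

section Energy

variable {d : ℕ} {Ω D : Set (Sp d)} {κ f : Sp d → ℝ}

theorem IsCoefficient.mono (hκ : IsCoefficient D κ) (hsub : Ω ⊆ D) : IsCoefficient Ω κ := by
  obtain ⟨hm, α, β, hα, h⟩ := hκ
  exact ⟨hm, α, β, hα, fun x hx => h x (hsub hx)⟩

theorem IsCoefficient.nonneg (hκ : IsCoefficient Ω κ) {x : Sp d} (hx : x ∈ Ω) : 0 ≤ κ x := by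
  obtain ⟨-, α, β, hα, h⟩ := hκ
  exact hα.le.trans (h x hx).1

theorem IsCoefficient.memLp_smul {F : Type*} [NormedAddCommGroup F] [NormedSpace ℝ F]
    (hκ : IsCoefficient Ω κ) (hΩ : MeasurableSet Ω) {a : Sp d → F}
    (ha : MemLp a 2 (volume.restrict Ω)) : MemLp (fun x => κ x • a x) 2 (volume.restrict Ω) := by
  have h0 := fun x => hκ.nonneg (x := x)
  obtain ⟨hm, α, β, hα, h⟩ := hκ
  refine memLp_smul_of_bound hm.aestronglyMeasurable (c := β) ?_ ha
  filter_upwards [ae_restrict_mem hΩ] with x hx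
  rw [Real.norm_of_nonneg (h0 x hx)]
  exact (h x hx).2

theorem IsCoefficient.integrable {F : Type*} [NormedAddCommGroup F] [InnerProductSpace ℝ F]
    (hκ : IsCoefficient Ω κ) (hΩ : MeasurableSet Ω) {a b : Sp d → F}
    (ha : MemLp a 2 (volume.restrict Ω)) (hb : MemLp b 2 (volume.restrict Ω)) :
    Integrable (fun x => κ x * ⟪a x, b x⟫) (volume.restrict Ω) := by
  simpa only [real_inner_smul_left] using integrable_inner_of_memLp (hκ.memLp_smul hΩ ha) hb

theorem IsCoefficient.integrable_sq {F : Type*} [NormedAddCommGroup F] [InnerProductSpace ℝ F]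
    (hκ : IsCoefficient Ω κ) (hΩ : MeasurableSet Ω) {a : Sp d → F}
    (ha : MemLp a 2 (volume.restrict Ω)) :
    Integrable (fun x => κ x * ‖a x‖ ^ 2) (volume.restrict Ω) := by
  simpa only [real_inner_self_eq_norm_sq] using hκ.integrable hΩ ha ha

theorem energy_self (κ : Sp d → ℝ) (Ω : Set (Sp d)) (v : GFun d) :
    energy κ Ω v v = ∫ x in Ω, κ x * ‖v.2 x‖ ^ 2 := by
  simp only [energy, real_inner_self_eq_norm_sq]

theorem energy_self_nonneg (hκ : IsCoefficient Ω κ) (hΩ : MeasurableSet Ω) (v : GFun d) :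
    0 ≤ energy κ Ω v v := by
  rw [energy_self]
  exact setIntegral_nonneg hΩ fun x hx => mul_nonneg (hκ.nonneg hx) (by positivity)

theorem energy_sub_left (hκ : IsCoefficient Ω κ) (hΩ : MeasurableSet Ω) {u v w : GFun d}
    (hu : MemH1 Ω u) (hv : MemH1 Ω v) (hw : MemH1 Ω w) :
    energy κ Ω (u - v) w = energy κ Ω u w - energy κ Ω v w := by
  simp only [energy, Prod.snd_sub, Pi.sub_apply, inner_sub_left, mul_sub]
  exact integral_sub (hκ.integrable hΩ hu.memLp_grad hw.memLp_grad)
    (hκ.integrable hΩ hv.memLp_grad hw.memLp_grad)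

theorem energy_comm (κ : Sp d → ℝ) (Ω : Set (Sp d)) (v w : GFun d) :
    energy κ Ω v w = energy κ Ω w v := by
  simp only [energy, real_inner_comm]

/-- Orthogonality implies the best approximation property. -/
theorem energy_le_of_orthogonal (hκ : IsCoefficient Ω κ) (hΩ : MeasurableSet Ω) {v w : GFun d}
    (hv : MemH1 Ω v) (hw : MemH1 Ω w) (h : energy κ Ω v w = 0) :
    energy κ Ω v v ≤ energy κ Ω (v - w) (v - w) := by
  have h1 := energy_self_nonneg hκ hΩ w
  rw [energy_sub_left hκ hΩ hv hw (hv.sub hw), energy_comm κ Ω v (v - w), energy_comm κ Ω w (v - w),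
    energy_sub_left hκ hΩ hv hw hv, energy_sub_left hκ hΩ hv hw hw, energy_comm κ Ω w v, h]
  linarith

theorem mul_fderiv_eq_inner (φ : Sp d → ℝ) (x a : Sp d) :
    κ x * fderiv ℝ φ x a = κ x * ⟪a, gradient φ x⟫ := by
  rw [real_inner_comm, inner_gradient_left]

theorem IsWeakSol.mono {v : GFun d} (h : IsWeakSol κ f D v) (hsub : Ω ⊆ D)
    (hD : MeasurableSet D) : IsWeakSol κ f Ω v := by
  refine ⟨h.1.mono hsub hD, fun φ hφ => ?_⟩
  have := h.2 φ (hφ.mono hsub)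
  rwa [setIntegral_eq_of_subset_of_forall_sdiff_eq_zero hD hsub fun x hx => by
      rw [fderiv_eq_zero_of_notMem_tsupport fun h => hx.2 (hφ.subset h)]; simp,
    setIntegral_eq_of_subset_of_forall_sdiff_eq_zero hD hsub fun x hx => by
      rw [hφ.eq_zero hx.2]; simp] at this

theorem IsWeakSol.sub (hκ : IsCoefficient Ω κ) (hΩ : MeasurableSet Ω) {v w : GFun d}
    (hv : IsWeakSol κ f Ω v) (hw : IsWeakSol κ f Ω w) : IsWeakSol κ 0 Ω (v - w) := by
  refine ⟨hv.1.sub hw.1, fun φ hφ => ?_⟩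
  have hg := (hφ.memLp (volume.restrict Ω)).2
  have h1 := hv.2 φ hφ
  have h2 := hw.2 φ hφ
  simp only [mul_fderiv_eq_inner] at h1 h2 ⊢
  simp only [Prod.snd_sub, Pi.sub_apply, inner_sub_left, mul_sub]
  rw [integral_sub (hκ.integrable hΩ hv.1.memLp_grad hg) (hκ.integrable hΩ hw.1.memLp_grad hg),
    h1, h2]
  simp

/-- The harmonic functions form a linear space. -/
def harmonicSpace (hκ : IsCoefficient Ω κ) (hΩ : MeasurableSet Ω) : Submodule ℝ (GFun d) where
  carrier := {v | IsWeakSol κ 0 Ω v}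
  zero_mem' := ⟨MemH1.zero, fun φ _ => by simp⟩
  add_mem' := by
    rintro v w ⟨hv, hv'⟩ ⟨hw, hw'⟩
    refine ⟨hv.add hw, fun φ hφ => ?_⟩
    have hg := (hφ.memLp (volume.restrict Ω)).2
    have h1 := hv' φ hφ
    have h2 := hw' φ hφ
    simp only [mul_fderiv_eq_inner] at h1 h2 ⊢
    simp only [Prod.snd_add, Pi.add_apply, inner_add_left, mul_add]
    rw [integral_add (hκ.integrable hΩ hv.memLp_grad hg) (hκ.integrable hΩ hw.memLp_grad hg),
      h1, h2]
    simp
  smul_mem' := by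
    rintro c v ⟨hv, hv'⟩
    refine ⟨hv.smul c, fun φ hφ => ?_⟩
    have h1 := hv' φ hφ
    simp only [mul_fderiv_eq_inner] at h1 ⊢
    simp only [Prod.smul_snd, Pi.smul_apply, real_inner_smul_left, mul_left_comm _ c]
    rw [integral_const_mul, h1]
    simp

/-- A weak solution may be tested with functions in `H¹₀(Ω)`. -/
theorem IsWeakSol.energy_eq (hκ : IsCoefficient Ω κ) (hΩ : MeasurableSet Ω)
    (hf : MemLp f 2 (volume.restrict Ω)) {v w : GFun d} (hv : IsWeakSol κ f Ω v)
    (hw : MemH10 Ω w) : energy κ Ω v w = ∫ x in Ω, f x * w.1 x := by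
  obtain ⟨φ, hφ, l1, l2⟩ := hw.exists_seq
  have t1 := tendsto_integral_inner (hκ.memLp_smul hΩ hv.1.memLp_grad) hw.memLp_grad
    (fun k => ((hφ k).memLp (volume.restrict Ω)).2) l2
  have t2 := tendsto_integral_mul hf hw.memLp_fun
    (fun k => ((hφ k).memLp (volume.restrict Ω)).1) l1
  have he (k : ℕ) : ∫ x in Ω, ⟪κ x • v.2 x, gradient (φ k) x⟫ = ∫ x in Ω, f x * φ k x := by
    simp only [real_inner_smul_left, ← mul_fderiv_eq_inner, hv.2 _ (hφ k)]
  simp_rw [he] at t1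
  simpa only [energy, real_inner_smul_left] using tendsto_nhds_unique t1 t2

theorem mass_gradient_eq (κ η : Sp d → ℝ) (Ω : Set (Sp d)) (R : GFun d) :
    mass (fun x => κ x * ‖fderiv ℝ η x‖ ^ 2) Ω R R =
      ∫ x in Ω, κ x * ‖R.1 x • gradient η x‖ ^ 2 := by
  refine integral_congr_ae (Eventually.of_forall fun x => ?_)
  simp only [norm_smul, norm_gradient, mul_pow, Real.norm_eq_abs, sq_abs]
  ring

theorem memLp_lipschitz_smul {F : Type*} [NormedAddCommGroup F] [NormedSpace ℝ F] {η : Sp d → ℝ}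
    {K : NNReal} (hη : LipschitzWith K η) (hΩ : MeasurableSet Ω) (hb : Bornology.IsBounded Ω)
    {a : Sp d → F} (ha : MemLp a 2 (volume.restrict Ω)) :
    MemLp (fun x => η x • a x) 2 (volume.restrict Ω) := by
  obtain ⟨c, hc⟩ := exists_bound_of_lipschitz hη hb
  refine memLp_smul_of_bound hη.continuous.aestronglyMeasurable (c := c) ?_ ha
  filter_upwards [ae_restrict_mem hΩ] with x hx using hc x hx

/-- The Caccioppoli inequality, up to the part of the boundary where the function vanishes. -/
theorem caccioppoli (hΩ : IsOpen Ω) (hb : Bornology.IsBounded Ω) (hκ : IsCoefficient Ω κ)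
    {R : GFun d} (hR : IsWeakSol κ 0 Ω R) (hz : ZeroOnBoundary D Ω R) {η : Sp d → ℝ} {K : NNReal}
    (hη : LipschitzWith K η) (h0 : ∀ x ∈ D \ Ω, η x = 0) :
    ∫ x in Ω, κ x * ‖η x • R.2 x‖ ^ 2 ≤
      4 * mass (fun x => κ x * ‖fderiv ℝ η x‖ ^ 2) Ω R R := by
  -- The test function is `η²R`: the first factor `η` puts the product into H¹₀(Ω), the second keeps
  -- it there.
  have hv := (hz.cutoffMul hη hΩ hb h0).lipMul hη hΩ hb
  have he := hR.energy_eq hκ hΩ.measurableSet MemLp.zero hv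
  simp only [Pi.zero_apply, zero_mul, integral_zero] at he
  have m1 := memLp_lipschitz_smul hη hΩ.measurableSet hb hR.1.memLp_grad
  have m2 := memLp_smul_gradient hη hR.1.memLp_fun
  have i1 := hκ.integrable_sq hΩ.measurableSet m1
  have i2 := hκ.integrable_sq hΩ.measurableSet m2
  have hle : ∫ x in Ω, (1 / 2 * (κ x * ‖η x • R.2 x‖ ^ 2) -
      2 * (κ x * ‖R.1 x • gradient η x‖ ^ 2)) ≤ 0 := by
    rw [← he]
    refine setIntegral_mono_on ((i1.const_mul _).sub (i2.const_mul _))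
      (hκ.integrable hΩ.measurableSet hR.1.memLp_grad hv.memLp_grad) hΩ.measurableSet
      fun x hx => ?_
    have hin : ⟪R.2 x, (lipMul η (cutoffMul η R)).2 x⟫ =
        ‖η x • R.2 x‖ ^ 2 + 2 * ⟪η x • R.2 x, R.1 x • gradient η x⟫ := by
      by_cases hx0 : η x = 0
      · simp [lipMul, cutoffMul, hx0]
      · have hn : x ∈ {x | η x ≠ 0} := hx0
        simp only [lipMul, cutoffMul, Set.indicator_of_mem hn, inner_add_right,
          real_inner_smul_right, real_inner_smul_left, ← real_inner_self_eq_norm_sq]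
        ring
    -- Half of this square is Young's inequality `|a|² + 2⟨a, b⟩ ≥ |a|²/2 - 2|b|²`, the source of
    -- the constant 4.
    have hsq : 0 ≤ ‖η x • R.2 x + (2 : ℝ) • (R.1 x • gradient η x)‖ ^ 2 := by positivity
    rw [norm_add_sq_real, real_inner_smul_right, norm_smul (2 : ℝ), Real.norm_two, mul_pow 2] at hsq
    rw [hin]
    have hk := hκ.nonneg hx
    nlinarith [mul_nonneg hk hsq]
  rw [integral_sub (i1.const_mul _) (i2.const_mul _), integral_const_mul, integral_const_mul] at hle
  rw [mass_gradient_eq]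
  linarith

/-- The product rule gives `2|η∇R|² + 2|R∇η|²`, and Caccioppoli's inequality bounds the first part
by the mass: `2 · 4 + 2 = 10`. -/
theorem energy_cutoffMul_le (hΩ : IsOpen Ω) (hb : Bornology.IsBounded Ω) (hκ : IsCoefficient Ω κ)
    {R : GFun d} (hR : IsWeakSol κ 0 Ω R) (hz : ZeroOnBoundary D Ω R) {η : Sp d → ℝ} {K : NNReal}
    (hη : LipschitzWith K η) (h0 : ∀ x ∈ D \ Ω, η x = 0) :
    energy κ Ω (cutoffMul η R) (cutoffMul η R) ≤
      10 * mass (fun x => κ x * ‖fderiv ℝ η x‖ ^ 2) Ω R R := by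
  have hc := caccioppoli hΩ hb hκ hR hz hη h0
  have hv := hz.cutoffMul hη hΩ hb h0
  have i1 := hκ.integrable_sq hΩ.measurableSet
    (memLp_lipschitz_smul hη hΩ.measurableSet hb hR.1.memLp_grad)
  have i2 := hκ.integrable_sq hΩ.measurableSet (memLp_smul_gradient hη hR.1.memLp_fun)
  have hle : energy κ Ω (cutoffMul η R) (cutoffMul η R) ≤
      ∫ x in Ω, (2 * (κ x * ‖η x • R.2 x‖ ^ 2) + 2 * (κ x * ‖R.1 x • gradient η x‖ ^ 2)) := by
    rw [energy_self]
    refine setIntegral_mono_on (hκ.integrable_sq hΩ.measurableSet hv.memLp_grad)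
      ((i1.const_mul _).add (i2.const_mul _)) hΩ.measurableSet fun x hx => ?_
    have h1 : ‖(cutoffMul η R).2 x‖ ≤ ‖η x • R.2 x‖ + ‖R.1 x • gradient η x‖ :=
      (norm_indicator_le_norm_self _ x).trans (norm_add_le _ _)
    have h2 : ‖(cutoffMul η R).2 x‖ ^ 2 ≤
        2 * ‖η x • R.2 x‖ ^ 2 + 2 * ‖R.1 x • gradient η x‖ ^ 2 := by
      have := pow_le_pow_left₀ (norm_nonneg _) h1 2
      nlinarith [sq_nonneg (‖η x • R.2 x‖ - ‖R.1 x • gradient η x‖)]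
    have := mul_le_mul_of_nonneg_left h2 (hκ.nonneg hx)
    linarith
  rw [integral_add (i1.const_mul _) (i2.const_mul _), integral_const_mul, integral_const_mul,
    ← mass_gradient_eq] at hle
  linarith

end Energy

/-! ### Remainders, local estimates and finite overlap. -/

section Convergence

variable {d : ℕ} {Ω D : Set (Sp d)} {κ f : Sp d → ℝ}

theorem MemH10.neg {v : GFun d} (hv : MemH10 Ω v) : MemH10 Ω (-v) := by
  refine ⟨hv.memLp_fun.neg, hv.memLp_grad.neg, fun ε hε => ?_⟩
  obtain ⟨φ, hφ, l1, l2⟩ := hv.approx ε hε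
  have hgrad : gradient (-φ) = -gradient φ := by
    ext1 x
    refine ext_inner_right ℝ fun e => ?_
    rw [inner_gradient_left, fderiv_neg]
    simp [inner_gradient_left]
  refine ⟨-φ, ⟨hφ.smooth.neg, hφ.compact.neg, ?_⟩, ?_, ?_⟩
  · rw [tsupport_neg]
    exact hφ.subset
  · rw [Prod.fst_neg, ← neg_sub', eLpNorm_neg]
    exact l1
  · rw [hgrad, Prod.snd_neg, ← neg_sub', eLpNorm_neg]
    exact l2

theorem cutoffMul_fst_eq_zero {η : Sp d → ℝ} {w : GFun d} {x : Sp d} (hx : η x = 0) :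
    (cutoffMul η w).1 x = 0 := by
  simp [cutoffMul, lipMul, hx]

theorem cutoffMul_snd_eq_zero {η : Sp d → ℝ} {w : GFun d} {x : Sp d} (hx : η x = 0) :
    (cutoffMul η w).2 x = 0 := by
  simp [cutoffMul, hx]

theorem localSpace_le_harmonicSpace (hκ : IsCoefficient Ω κ) (hΩ : MeasurableSet Ω) {M r : ℕ}
    {ψ : Fin M → GFun d} (hψ : ∀ l, IsWeakSol κ 0 Ω (ψ l)) (Ψ : Fin r → Fin M → ℝ) (L : Fin r) :
    localSpace ψ Ψ L ≤ harmonicSpace hκ hΩ := by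
  refine Submodule.span_le.2 ?_
  rintro w ⟨k, -, rfl⟩
  exact Submodule.sum_mem _ fun l _ => Submodule.smul_mem _ _ (hψ l)

/-- What remains of the solution after subtracting interpolants is harmonic. -/
theorem isWeakSol_remainder (hκ : IsCoefficient Ω κ) (hΩ : MeasurableSet Ω) {p M : ℕ}
    {u b : GFun d} (hu : IsWeakSol κ f Ω u) (hb : IsWeakSol κ f Ω b) {ψ : Fin M → GFun d}
    (hψ : ∀ l, IsWeakSol κ 0 Ω (ψ l)) {r : Fin (p + 1) → ℕ} {Ψ : ∀ j, Fin (r j) → Fin M → ℝ}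
    {L : ∀ j, Fin (r j)} {I : Fin (p + 1) → GFun d}
    (hI : ∀ j, I j - (if j = 0 then b else 0) ∈ localSpace ψ (Ψ j) (L j)) (j : Fin (p + 1)) :
    IsWeakSol κ 0 Ω (u - ∑ k ∈ Finset.Iic j, I k) := by
  have h1 : ∑ k ∈ Finset.Iic j, (I k - if k = 0 then b else 0) ∈ harmonicSpace hκ hΩ :=
    Submodule.sum_mem _ fun k _ => localSpace_le_harmonicSpace hκ hΩ hψ _ _ (hI k)
  have h2 : u - b ∈ harmonicSpace hκ hΩ := hu.sub hκ hΩ hb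
  have h3 := Submodule.sub_mem _ h2 h1
  -- The index `0` lies in every `Iic j`, so `b` is subtracted exactly once and cancels against `u -
  -- b`.
  rw [Finset.sum_sub_distrib, Finset.sum_ite_eq', if_pos (by simp), sub_sub_sub_cancel_right] at h3
  exact h3

/-- Each half of the chain costs one factor `C₀`. In this form the mass of a remainder is controlled
by the energy of the one before it, as the descent requires. -/
theorem InterpolationBound.mass_le {C₀ lam : ℝ} (hC₀ : 0 ≤ C₀) {χ : Sp d → ℝ} {w R : GFun d}
    (h : InterpolationBound C₀ κ Ω χ lam w R) :
    mass (fun x => κ x * ‖fderiv ℝ χ x‖ ^ 2) Ω R R ≤ C₀ ^ 2 * (1 / lam * energy κ Ω w w) := by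
  refine h.1.trans ((mul_le_mul_of_nonneg_left h.2 hC₀).trans (le_of_eq ?_))
  ring

/-- The energy in a smaller region where the cutoff is bounded below. -/
theorem energy_le_of_lower (hΩ : MeasurableSet Ω) (hD : MeasurableSet D) (hsub : Ω ⊆ D)
    (hb : Bornology.IsBounded D) (hκ : IsCoefficient D κ) {R : GFun d} (hR : MemH1 D R)
    {η : Sp d → ℝ} {K : NNReal} (hη : LipschitzWith K η) {c : ℝ} (hc : 0 < c)
    (hlow : ∀ x ∈ Ω, c ≤ |η x|) :
    energy κ Ω R R ≤ (c ^ 2)⁻¹ * ∫ x in D, κ x * ‖η x • R.2 x‖ ^ 2 := by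
  have i1 := hκ.integrable_sq hD (memLp_lipschitz_smul hη hD hb hR.memLp_grad)
  have i2 := hκ.integrable_sq hD hR.memLp_grad
  rw [energy_self, ← integral_const_mul]
  refine (setIntegral_mono_on (i2.mono_measure (Measure.restrict_mono hsub le_rfl))
    ((i1.const_mul _).mono_measure (Measure.restrict_mono hsub le_rfl)) hΩ
    (g := fun x => (c ^ 2)⁻¹ * (κ x * ‖η x • R.2 x‖ ^ 2)) fun x hx => ?_).trans ?_
  · have hk := hκ.nonneg (hsub hx)
    have h1 : c ^ 2 ≤ |η x| ^ 2 := pow_le_pow_left₀ hc.le (hlow x hx) 2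
    rw [norm_smul, mul_pow, Real.norm_eq_abs, inv_mul_eq_div, le_div_iff₀ (by positivity)]
    have := mul_le_mul_of_nonneg_left h1 (mul_nonneg hk (sq_nonneg ‖R.2 x‖))
    linarith
  · refine setIntegral_mono_set (i1.const_mul _) ?_ (Filter.Eventually.of_forall hsub)
    filter_upwards [ae_restrict_mem hD] with x hx
    have hk := hκ.nonneg hx
    simp only [Pi.zero_apply]
    positivity

/-- The local energies of a function add up to at most the energy times the overlap. -/
theorem sum_energy_le {m N : ℕ} (hD : MeasurableSet D) (hκ : IsCoefficient D κ)
    {U : Fin m → Set (Sp d)} (hU : ∀ i, MeasurableSet (U i)) (hsub : ∀ i, U i ⊆ D)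
    (hN : ∀ x ∈ D, Set.ncard {i | x ∈ U i} ≤ N) {u : GFun d} (hu : MemH1 D u) :
    ∑ i, energy κ (U i) u u ≤ N * energy κ D u u := by
  classical
  have i1 := hκ.integrable_sq hD hu.memLp_grad
  have h1 (i) : energy κ (U i) u u =
      ∫ x in D, (U i).indicator (fun x => κ x * ‖u.2 x‖ ^ 2) x := by
    rw [energy_self, setIntegral_indicator (hU i), Set.inter_eq_self_of_subset_right (hsub i)]
  simp_rw [h1]
  rw [← integral_finsetSum _ fun i _ => i1.indicator (hU i), energy_self, ← integral_const_mul]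
  refine setIntegral_mono_on (integrable_finsetSum _ fun i _ => i1.indicator (hU i))
    (i1.const_mul _) hD fun x hx => ?_
  have hk := hκ.nonneg hx
  simp only [Set.indicator_apply]
  rw [← Finset.sum_filter, Finset.sum_const, nsmul_eq_mul]
  gcongr
  have := hN x hx
  rwa [Set.ncard_eq_toFinset_card', Set.toFinset_ofPred] at this

/-- Cauchy–Schwarz over the nonzero terms only, so that the constant counts the overlap and not the
number of nodes. -/
theorem norm_sum_sq_le_of_ncard {F : Type*} [NormedAddCommGroup F] {m N : ℕ} {G : Fin m → F}
    {s : Set (Fin m)} (hs : s.ncard ≤ N) (h0 : ∀ i ∉ s, G i = 0) :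
    ‖∑ i, G i‖ ^ 2 ≤ N * ∑ i ∈ s.toFinite.toFinset, ‖G i‖ ^ 2 := by
  classical
  have h1 : ∑ i, G i = ∑ i ∈ s.toFinite.toFinset, G i := by
    symm
    refine Finset.sum_subset (Finset.subset_univ _) fun i _ hi => h0 i ?_
    simpa using hi
  have h2 : (s.toFinite.toFinset.card : ℝ) ≤ N := by
    rw [← Set.ncard_eq_toFinset_card s]
    exact_mod_cast hs
  rw [h1]
  calc ‖∑ i ∈ s.toFinite.toFinset, G i‖ ^ 2
      ≤ (∑ i ∈ s.toFinite.toFinset, ‖G i‖) ^ 2 := by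
        gcongr
        exact norm_sum_le _ _
    _ ≤ s.toFinite.toFinset.card * ∑ i ∈ s.toFinite.toFinset, ‖G i‖ ^ 2 :=
        sq_sum_le_card_mul_sum_sq
    _ ≤ _ := by gcongr

/-- The energy of a sum of functions with local support. -/
theorem energy_sum_le {m N : ℕ} (hD : MeasurableSet D) (hκ : IsCoefficient D κ)
    {U : Fin m → Set (Sp d)} (hU : ∀ i, MeasurableSet (U i)) (hsub : ∀ i, U i ⊆ D)
    (hN : ∀ x ∈ D, Set.ncard {i | x ∈ U i} ≤ N) {e : Fin m → GFun d}
    (he : ∀ i, MemLp (e i).2 2 (volume.restrict D)) (h0 : ∀ i, ∀ x ∈ D \ U i, (e i).2 x = 0) :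
    energy κ D (∑ i, e i) (∑ i, e i) ≤ N * ∑ i, energy κ (U i) (e i) (e i) := by
  classical
  have i1 (i) := hκ.integrable_sq hD (he i)
  have h1 (i) : energy κ (U i) (e i) (e i) =
      ∫ x in D, (U i).indicator (fun x => κ x * ‖(e i).2 x‖ ^ 2) x := by
    rw [energy_self, setIntegral_indicator (hU i), Set.inter_eq_self_of_subset_right (hsub i)]
  simp_rw [h1]
  rw [← integral_finsetSum _ fun i _ => (i1 i).indicator (hU i), energy_self,
    ← integral_const_mul]
  have hsum : MemLp (∑ i, e i).2 2 (volume.restrict D) := by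
    rw [Prod.snd_sum]
    exact memLp_finsetSum' _ fun i _ => he i
  refine setIntegral_mono_on (hκ.integrable_sq hD hsum)
    ((integrable_finsetSum _ fun i _ => (i1 i).indicator (hU i)).const_mul _) hD fun x hx => ?_
  have hk := hκ.nonneg hx
  have h2 := norm_sum_sq_le_of_ncard (hN x hx) (G := fun i => (e i).2 x) fun i hi =>
    h0 i x ⟨hx, hi⟩
  have h3 : ∑ i, (U i).indicator (fun x => κ x * ‖(e i).2 x‖ ^ 2) x =
      κ x * ∑ i ∈ ({i | x ∈ U i} : Set (Fin m)).toFinite.toFinset, ‖(e i).2 x‖ ^ 2 := by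
    simp only [Set.indicator_apply]
    rw [← Finset.sum_filter, Finset.mul_sum]
    congr 1
    ext i
    simp
  rw [h3, Prod.snd_sum, Finset.sum_apply, mul_left_comm]
  exact mul_le_mul_of_nonneg_left h2 hk

/-- The glued interpolants lie in the trial space. -/
theorem sum_mul_mem_offlineSpace {m p : ℕ} (χ : Fin m → Sp d → ℝ) {b : Fin m → GFun d}
    {M : Fin m → ℕ} {ψ : ∀ i, Fin (M i) → GFun d} {r : Fin m → Fin (p + 1) → ℕ}
    {Ψ : ∀ i j, Fin (r i j) → Fin (M i) → ℝ} {L : ∀ i j, Fin (r i j)}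
    {I : Fin m → Fin (p + 1) → GFun d}
    (hI : ∀ i j, I i j - (if j = 0 then b i else 0) ∈ localSpace (ψ i) (Ψ i j) (L i j)) :
    ((fun x => ∑ i, χ i x * (∑ k, I i k).1 x) - fun x => ∑ i, χ i x * (b i).1 x) ∈
      offlineSpace χ ψ Ψ L := by
  have key (i j) (w : GFun d) (hw : w ∈ localSpace (ψ i) (Ψ i j) (L i j)) :
      (fun x => χ i x * w.1 x) ∈ offlineSpace χ ψ Ψ L := by
    let T : GFun d →ₗ[ℝ] (Sp d → ℝ) := (LinearMap.mulLeft ℝ (χ i)).comp (LinearMap.fst ℝ _ _)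
    have : localSpace (ψ i) (Ψ i j) (L i j) ≤ (offlineSpace χ ψ Ψ L).comap T := by
      refine Submodule.span_le.2 ?_
      rintro w ⟨k, hk, rfl⟩
      exact Submodule.subset_span ⟨i, j, k, hk, rfl⟩
    exact this hw
  have h := Submodule.sum_mem (offlineSpace χ ψ Ψ L) (t := Finset.univ) fun i _ =>
    Submodule.sum_mem (offlineSpace χ ψ Ψ L) (t := Finset.univ) fun j _ => key i j _ (hI i j)
  convert h using 1
  ext1 x
  simp only [Pi.sub_apply, Finset.sum_apply, ← Finset.sum_sub_distrib, ← mul_sub]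
  refine Finset.sum_congr rfl fun i _ => ?_
  rw [← Finset.mul_sum]
  congr 1
  have h2 : ∑ j, (I i j - if j = 0 then b i else 0) = ∑ j, I i j - b i := by
    rw [Finset.sum_sub_distrib, Finset.sum_ite_eq', if_pos (Finset.mem_univ _)]
  have h3 := congrFun (congrArg Prod.fst h2) x
  rw [Prod.fst_sum, Finset.sum_apply, Prod.fst_sub, Pi.sub_apply] at h3
  exact h3.symm

end Convergence

end GMsFEM

/-! ### The error estimate. -/

theorem mainTheorem2 (p N : ℕ) (C₀ c₀ : ℝ) (hC₀ : 0 < C₀) (hc₀ : 0 < c₀) :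
    ∃ C : ℝ, 0 < C ∧
      ∀ (d m : ℕ) (D : Set (GMsFEM.Sp d)) (κ f : GMsFEM.Sp d → ℝ) (u : GMsFEM.GFun d)
        -- neighborhoods, oversampled regions, cutoffs
        (Ω : Fin m → Fin (p + 1) → Set (GMsFEM.Sp d))
        (χ : Fin m → Fin (p + 1) → GMsFEM.Sp d → ℝ)
        -- local particular functions and harmonic snapshots
        (b : Fin m → GMsFEM.GFun d) (M : Fin m → ℕ)
        (ψ : ∀ i, Fin (M i) → GMsFEM.GFun d)
        -- spectral problems
        (ρ : Fin m → Fin (p + 1) → GMsFEM.Sp d → ℝ) (r : Fin m → Fin (p + 1) → ℕ)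
        (lam : ∀ i j, Fin (r i j) → ℝ) (Ψ : ∀ i j, Fin (r i j) → Fin (M i) → ℝ)
        (L : ∀ i j, Fin (r i j))
        -- interpolants and the numerical solution
        (I : Fin m → Fin (p + 1) → GMsFEM.GFun d) (uH : GMsFEM.GFun d),
        IsOpen D → D.Nonempty → Bornology.IsBounded D →
        GMsFEM.IsCoefficient D κ →
        MemLp f 2 (volume.restrict D) →
        GMsFEM.IsWeakSol κ f D u →
        GMsFEM.IsOversampledCover D N c₀ Ω χ →
        (∀ i, GMsFEM.IsWeakSol κ f (Ω i 0) (b i)) →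
        (∀ i l, GMsFEM.IsWeakSol κ 0 (Ω i 0) (ψ i l)) →
        (∀ i j, GMsFEM.IsWeight (Ω i j) (ρ i j)) →
        (∀ i j, GMsFEM.IsEigensystem (GMsFEM.stiffnessMatrix κ (Ω i j) (ψ i))
          (GMsFEM.massMatrix (ρ i j) (Ω i j) (ψ i)) (lam i j) (Ψ i j)) →
        (∀ i j, 0 < lam i j (L i j)) →
        -- the interpolants lie in the selected local spaces, respect the boundary values,
        -- and satisfy the interpolation bounds, the one of level `j` being applied to what
        -- the preceding levels have left over
        (∀ i j, I i j - (if j = 0 then b i else 0) ∈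
          GMsFEM.localSpace (ψ i) (Ψ i j) (L i j)) →
        (∀ i j, GMsFEM.ZeroOnBoundary D (Ω i j) (u - ∑ k ∈ Finset.Iic j, I i k)) →
        (∀ i j, GMsFEM.InterpolationBound C₀ κ (Ω i j) (χ i j) (lam i j (L i j))
          (u - ∑ k ∈ Finset.Iio j, I i k) (u - ∑ k ∈ Finset.Iic j, I i k)) →
        GMsFEM.IsGalerkinSol D κ f u (fun i => χ i (Fin.last p)) b
          (GMsFEM.offlineSpace (fun i => χ i (Fin.last p)) ψ Ψ L) uH →
        GMsFEM.energy κ D (u - uH) (u - uH) ≤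
          C * (∏ j, 1 / (⨅ i, lam i j (L i j))) * GMsFEM.energy κ D u u := by
  classical
  -- The price of one descent: 4 from Caccioppoli, `C₀²` from the interpolation bound, `c₀⁻²` from
  -- the lower bound of the cutoff.
  set q : ℝ := 4 * C₀ ^ 2 / c₀ ^ 2 with hq
  have hq0 : 0 ≤ q := by positivity
  -- There are `p` descents and one final estimate with factor `10 C₀²`; the overlap is paid for
  -- twice. The added one keeps the constant positive for `N = 0`.
  refine ⟨10 * C₀ ^ 2 * q ^ p * N ^ 2 + 1, by positivity, ?_⟩
  intro d m D κ f u Ω χ b M ψ ρ r lam Ψ L I uH hD hDne hDb hκ hf hu hcov hb hψ _ _ hlam hI hz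
    hint hG
  have hκi (i j) : GMsFEM.IsCoefficient (Ω i j) κ := hκ.mono (hcov.subset i j)
  have hharm (i j) : GMsFEM.IsWeakSol κ 0 (Ω i j) (u - ∑ k ∈ Finset.Iic j, I i k) :=
    (GMsFEM.isWeakSol_remainder (hκi i 0) (hcov.isOpen i 0).measurableSet
      (hu.mono (hcov.subset i 0) hD.measurableSet) (hb i) (hψ i) (hI i) j).mono
      (hcov.nested i (Fin.zero_le j)) (hcov.isOpen i 0).measurableSet
  have hmass (i j) := GMsFEM.InterpolationBound.mass_le hC₀.le (hint i j)
  -- positivity of the spectral gaps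
  obtain ⟨x₀, hx₀⟩ := hDne
  -- Without nodes the infimum below would take the default value zero; the partition of unity at a
  -- point of D excludes this.
  have hm : Nonempty (Fin m) := by
    by_contra h
    rw [not_nonempty_iff] at h
    simpa using hcov.partition x₀ hx₀
  have hbdd (j) : BddBelow (Set.range fun i => lam i j (L i j)) := (Set.finite_range _).bddBelow
  have hΛ (j) : 0 < ⨅ i, lam i j (L i j) := by
    obtain ⟨i, hi⟩ := exists_eq_ciInf_of_finite (f := fun i => lam i j (L i j))
    rw [← hi]
    exact hlam i j
  have hΛle (i j) : 1 / lam i j (L i j) ≤ 1 / ⨅ i, lam i j (L i j) :=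
    one_div_le_one_div_of_le (hΛ j) (ciInf_le (hbdd j) i)
  have hE (i j v) : 0 ≤ GMsFEM.energy κ (Ω i j) v v :=
    GMsFEM.energy_self_nonneg (hκi i j) (hcov.isOpen i j).measurableSet v
  -- descent through the levels
  have hdesc (i) (j : Fin (p + 1)) :
      GMsFEM.energy κ (Ω i j) (u - ∑ k ∈ Finset.Iio j, I i k) (u - ∑ k ∈ Finset.Iio j, I i k) ≤
        q ^ (j : ℕ) * (∏ k ∈ Finset.Iio j, 1 / ⨅ i, lam i k (L i k)) *
          GMsFEM.energy κ (Ω i 0) u u := by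
    induction j using Fin.induction with
    | zero =>
      have : Finset.Iio (0 : Fin (p + 1)) = ∅ := by ext k; simp
      simp [this]
    | succ j ih =>
      -- What enters a level is what the preceding level has left over.
      have hset : Finset.Iio j.succ = Finset.Iic j.castSucc := by
        ext k
        simp [Fin.lt_def, Fin.le_def]
      obtain ⟨K, hK⟩ := hcov.lipschitz i j.castSucc
      have hc := GMsFEM.caccioppoli (hcov.isOpen i j.castSucc) (hDb.subset (hcov.subset i _))
        (hκi i j.castSucc) (hharm i j.castSucc) (hz i j.castSucc) hK (hcov.vanish i _)
      have hlow := GMsFEM.energy_le_of_lower (hcov.isOpen i j.succ).measurableSet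
        (hcov.isOpen i j.castSucc).measurableSet (hcov.nested i (Fin.castSucc_lt_succ (i := j)).le)
        (hDb.subset (hcov.subset i _)) (hκi i j.castSucc) (hharm i j.castSucc).1 hK hc₀
        (hcov.lower i j)
      rw [hset, ← Finset.Iio_insert, Finset.prod_insert (by simp), Finset.Iio_insert]
      have h1 := hmass i j.castSucc
      have h2 : 1 / lam i j.castSucc (L i j.castSucc) *
          GMsFEM.energy κ (Ω i j.castSucc) (u - ∑ k ∈ Finset.Iio j.castSucc, I i k)
            (u - ∑ k ∈ Finset.Iio j.castSucc, I i k) ≤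
          (1 / ⨅ i, lam i j.castSucc (L i j.castSucc)) *
            (q ^ (j : ℕ) * (∏ k ∈ Finset.Iio j.castSucc, 1 / ⨅ i, lam i k (L i k)) *
              GMsFEM.energy κ (Ω i 0) u u) :=
        mul_le_mul (hΛle i j.castSucc) ih (hE _ _ _) (one_div_pos.2 (hΛ _)).le
      calc GMsFEM.energy κ (Ω i j.succ) (u - ∑ k ∈ Finset.Iic j.castSucc, I i k)
            (u - ∑ k ∈ Finset.Iic j.castSucc, I i k)
          ≤ (c₀ ^ 2)⁻¹ * (4 * (C₀ ^ 2 * ((1 / ⨅ i, lam i j.castSucc (L i j.castSucc)) *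
            (q ^ (j : ℕ) * (∏ k ∈ Finset.Iio j.castSucc, 1 / ⨅ i, lam i k (L i k)) *
              GMsFEM.energy κ (Ω i 0) u u)))) := by
            refine hlow.trans (mul_le_mul_of_nonneg_left (hc.trans ?_) (by positivity))
            refine mul_le_mul_of_nonneg_left (h1.trans ?_) (by norm_num)
            exact mul_le_mul_of_nonneg_left h2 (by positivity)
        _ = _ := by
            rw [Fin.val_succ, pow_succ, hq]
            ring
  set P : ℝ := ∏ j, 1 / ⨅ i, lam i j (L i j) with hP
  have hP0 : 0 ≤ P := Finset.prod_nonneg fun j _ => (one_div_pos.2 (hΛ j)).le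
  have hIic : Finset.Iic (Fin.last p) = Finset.univ := by
    ext k
    simp [Fin.le_last]
  set χ' : Fin m → GMsFEM.Sp d → ℝ := fun i => χ i (Fin.last p) with hχ'
  set R : Fin m → GMsFEM.GFun d := fun i => u - ∑ k ∈ Finset.Iic (Fin.last p), I i k with hR
  set e : Fin m → GMsFEM.GFun d := fun i => GMsFEM.cutoffMul (χ' i) (R i) with he
  -- The last cutoff is the partition function, which has no lower bound. Here the product itself is
  -- estimated, and this supplies the last factor of `P`.
  have hloc (i) : GMsFEM.energy κ (Ω i (Fin.last p)) (e i) (e i) ≤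
      10 * C₀ ^ 2 * q ^ p * P * GMsFEM.energy κ (Ω i 0) u u := by
    obtain ⟨K, hK⟩ := hcov.lipschitz i (Fin.last p)
    have h0 := GMsFEM.energy_cutoffMul_le (hcov.isOpen i _) (hDb.subset (hcov.subset i _))
      (hκi i _) (hharm i (Fin.last p)) (hz i _) hK (hcov.vanish i _)
    have h1 := hmass i (Fin.last p)
    have h2 := mul_le_mul (hΛle i (Fin.last p)) (hdesc i (Fin.last p)) (hE _ _ _)
      (one_div_pos.2 (hΛ _)).le
    have hPs : P = (1 / ⨅ i, lam i (Fin.last p) (L i (Fin.last p))) *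
        ∏ k ∈ Finset.Iio (Fin.last p), 1 / ⨅ i, lam i k (L i k) := by
      rw [hP, ← hIic, ← Finset.Iio_insert, Finset.prod_insert (by simp)]
    calc GMsFEM.energy κ (Ω i (Fin.last p)) (e i) (e i)
        ≤ 10 * (C₀ ^ 2 * ((1 / ⨅ i, lam i (Fin.last p) (L i (Fin.last p))) *
          (q ^ p * (∏ k ∈ Finset.Iio (Fin.last p), 1 / ⨅ i, lam i k (L i k)) *
            GMsFEM.energy κ (Ω i 0) u u))) := by
          refine h0.trans (mul_le_mul_of_nonneg_left (h1.trans ?_) (by norm_num))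
          exact mul_le_mul_of_nonneg_left h2 (by positivity)
      _ = _ := by
          rw [hPs]
          ring
  have he10 (i) : GMsFEM.MemH10 D (e i) := by
    obtain ⟨K, hK⟩ := hcov.lipschitz i (Fin.last p)
    exact (((hz i (Fin.last p)).cutoffMul hK (hcov.isOpen i _) (hDb.subset (hcov.subset i _))
      (hcov.vanish i _)).extend (hcov.isOpen i _).measurableSet hD.measurableSet
      (hcov.subset i _) (fun x hx => GMsFEM.cutoffMul_fst_eq_zero (hcov.vanish i _ x hx))
      (fun x hx => GMsFEM.cutoffMul_snd_eq_zero (hcov.vanish i _ x hx)))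
  -- the competitor
  set v : GMsFEM.GFun d :=
    (fun x => ∑ i, χ' i x * (∑ k, I i k).1 x, u.2 - ∑ i, (e i).2) with hv
  -- On D one has `v - uH = -(uH - u) - ∑ e i`, because the partition functions add up to one there.
  -- The gradient component of `v` was chosen to make this exact.
  have hw10 : GMsFEM.MemH10 D (v - uH) := by
    refine ((hG.boundary.memH10 hD).neg.sub_sum Finset.univ fun i _ => he10 i).congr ?_ ?_
    · filter_upwards [MeasureTheory.ae_restrict_mem hD.measurableSet] with x hx
      have hpart := hcov.partition x hx
      have hs : ∑ i, (e i).1 x = u.1 x - ∑ i, χ' i x * (∑ k, I i k).1 x := by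
        simp only [he, GMsFEM.cutoffMul, GMsFEM.lipMul, hR, hIic, Prod.fst_sub, Pi.sub_apply,
          mul_sub, Finset.sum_sub_distrib]
        rw [← Finset.sum_mul, hpart, one_mul]
      simp only [Prod.fst_neg, Prod.fst_sub, Pi.neg_apply, Pi.sub_apply,
        Prod.fst_sum, Finset.sum_apply, hs, hv]
      ring
    · refine Filter.Eventually.of_forall fun x => ?_
      simp only [Prod.snd_neg, Prod.snd_sub, Pi.neg_apply, Pi.sub_apply,
        Prod.snd_sum, Finset.sum_apply, hv]
      abel
  have hwV : (v - uH).1 ∈ GMsFEM.offlineSpace χ' ψ Ψ L := by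
    have h1 := (GMsFEM.offlineSpace χ' ψ Ψ L).sub_mem
      (GMsFEM.sum_mul_mem_offlineSpace χ' hI) hG.trial
    convert h1 using 1
    ext1 x
    simp [hv]
  have horth : GMsFEM.energy κ D (u - uH) (v - uH) = 0 := by
    rw [GMsFEM.energy_sub_left hκ hD.measurableSet hu.1 hG.memH1 hw10.memH1,
      hu.energy_eq hκ hD.measurableSet hf hw10, hG.galerkin _ hwV hw10.zeroOnBoundary, sub_self]
  have hcea := GMsFEM.energy_le_of_orthogonal hκ hD.measurableSet (hu.1.sub hG.memH1) hw10.memH1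
    horth
  have hdiff : GMsFEM.energy κ D ((u - uH) - (v - uH)) ((u - uH) - (v - uH)) =
      GMsFEM.energy κ D (∑ i, e i) (∑ i, e i) := by
    have : ((u - uH) - (v - uH)).2 = (∑ i, e i).2 := by
      simp [hv, Prod.snd_sum]
    simp only [GMsFEM.energy, this]
  have hE0 : 0 ≤ GMsFEM.energy κ D u u := GMsFEM.energy_self_nonneg hκ hD.measurableSet u
  -- The overlap enters here on the smallest regions, through nestedness, and in `hov2` on the
  -- largest ones, where the local energies of `u` are summed.
  have hov1 := GMsFEM.energy_sum_le hD.measurableSet hκ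
    (fun i => (hcov.isOpen i (Fin.last p)).measurableSet) (fun i => hcov.subset i _)
    (N := N) (fun x hx => (Set.ncard_le_ncard (fun i hi => hcov.nested i (Fin.zero_le _) hi)
      (Set.toFinite _)).trans (hcov.overlap x hx)) (fun i => (he10 i).memLp_grad)
    (fun i x hx => GMsFEM.cutoffMul_snd_eq_zero (hcov.vanish i _ x hx))
  have hov2 := GMsFEM.sum_energy_le hD.measurableSet hκ
    (fun i => (hcov.isOpen i 0).measurableSet) (fun i => hcov.subset i _) hcov.overlap hu.1
  rw [hdiff] at hcea
  calc GMsFEM.energy κ D (u - uH) (u - uH)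
      ≤ N * ∑ i, GMsFEM.energy κ (Ω i (Fin.last p)) (e i) (e i) := hcea.trans hov1
    _ ≤ N * ∑ i, 10 * C₀ ^ 2 * q ^ p * P * GMsFEM.energy κ (Ω i 0) u u := by
        gcongr with i
        exact hloc i
    _ ≤ N * (10 * C₀ ^ 2 * q ^ p * P * (N * GMsFEM.energy κ D u u)) := by
        rw [← Finset.mul_sum]
        gcongr
    _ = 10 * C₀ ^ 2 * q ^ p * N ^ 2 * (P * GMsFEM.energy κ D u u) := by ring
    _ ≤ (10 * C₀ ^ 2 * q ^ p * N ^ 2 + 1) * (P * GMsFEM.energy κ D u u) := by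
        gcongr
        linarith
    _ = _ := by ring
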